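/- **Setting.** A nonlinear LC network is an oriented connected graph with $n+1$ nodes whose $b=k+p$ branches carry $k$ inductors $v_a=L_a(i_a)\,\frac{d i_a}{dt}$ and $p$ capacitors $v_\alpha=C_\alpha(q_\alpha)$, with $L_a,C_\alpha:\mathbb R\to\mathbb R$ smooth. Let $B$ be its $b\times n$ incidence matrix (one node being taken as reference), let $c\in\mathbb R^n$, and let $q=(q^1,\dots,q^m)\mapsto x=\mathcal Nq+\mathcal K$ be affine coordinates on the configuration space $M_c=\{x\in\mathbb R^b: B^Tx=c\}$. The Birkhoffian of the network is $\sum_j\mathfrak Q_j\,dq^j$ with $$\mathfrak Q_j(q,\dot q,\ddot q)=\sum_a \mathcal N^a_j\,L_a\Big(\sum_l\mathcal N^a_l\dot q^l\Big)\sum_i\mathcal N^a_i\ddot q^i+\sum_\alpha \mathcal N^\alpha_j\,C_\alpha\Big(\sum_l\mathcal N^\alpha_lq^l+\mathcal K^\alpha\Big).$$ It is regular if $\det[\partial\mathfrak Q_j/\partial\ddot q^i]\neq0$ everywhere and for each $(q,\dot q)$ there is a $\ddot q$ with $\mathfrak Q(q,\dot q,\ddot q)=0$. A motion is a curve $(q(t),\dot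 q(t))$ with $\mathfrak Q(q,\dot q,\ddot q)=0$; $(q_e,0)$ is an equilibrium point if $\mathfrak Q_j(q_e,0,0)=0$ for all $j$. Write $x_a=\sum_i\mathcal N^a_i\dot q^i$, $y_\alpha=\sum_i\mathcal N^\alpha_iq^i+\mathcal K^\alpha$, and let $$E(q,\dot q)=\sum_{a}\sum_{l=1}^m\sum_{i_1<\dots<i_l}(-1)^{l+1}\int\!\cdots\!\int\big[L_a^{(l-1)}(x_a)\,x_a+(l-1)L_a^{(l-2)}(x_a)\big]\mathcal N^a_{i_1}\cdots\mathcal N^a_{i_l}\,d\dot q^{i_1}\cdots d\dot q^{i_l}$$ $$\qquad+\sum_{\alpha}\sum_{l=1}^m\sum_{i_1<\dots<i_l}(-1)^{l+1}\int\!\cdots\!\int C_\alpha^{(l-1)}(y_\alpha)\,\mathcal N^\alpha_{i_1}\cdots\mathcal N^\alpha_{i_l}\,dq^{i_1}\cdots dq^{i_l},$$ where every integral in a variable $q^i$ or $\dot q^i$ runs from $0$ to the value of that variable, the other variables being kept fixed. **Theorem 2.** The Birkhoffian is regular if and only if $\det\big[\sum_a\mathcal N^a_j\mathcal N^a_iL_a(\sum_l\mathcal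 N^a_l\dot q^l)\big]_{j,i}\ne0$ for all $\dot q$. Suppose that it is regular. 1. $E$ is smooth, $\sum_j\mathfrak Q_j\dot q^j=\sum_j\big[\frac{\partial E}{\partial q^j}\dot q^j+\frac{\partial E}{\partial\dot q^j}\ddot q^j\big]$ identically in $(q,\dot q,\ddot q)$, and $E$ is constant along every motion. 2. $(q_e,0)$ is an equilibrium point if and only if $\sum_\alpha\mathcal N^\alpha_jC_\alpha(\sum_l\mathcal N^\alpha_lq_e^l+\mathcal K^\alpha)=0$ for $j=1,\dots,m$. 3. Let $(q_e,0)$ be an equilibrium point and suppose that the network has no loop formed only by inductors, that $L_a(0)>0$ for all $a$, and that $C_\alpha'(\sum_l\mathcal N^\alpha_lq_e^l+\mathcal K^\alpha)>0$ for all $\alpha$. Put $V(q,\dot q)=E(q,\dot q)-E(q_e,0)$. Then the Hessian of $V$ at $(q_e,0)$, with the variables in the order $(\dot q,q)$, is $$\begin{pmatrix}\sum_aL_a(0)\mathcal N^a_i\mathcal N^a_j&0\\0&\sum_\alpha C'_\alpha(\sum_l\mathcal N^\alpha_lq_e^l+\mathcal K^\alpha)\mathcal N^\alpha_i\mathcal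 N^\alpha_j\end{pmatrix}$$ and it is positive definite. The equilibrium $(q_e,0)$ is Liapunov stable: every neighbourhood $\Omega$ of it contains a neighbourhood $\Omega_1$ such that from every state in $\Omega_1$ a motion starts that exists for all $t\ge0$, and every motion that starts in $\Omega_1$ remains in $\Omega$. It is a center: on a neighbourhood of $(q_e,0)$ the function $V$ vanishes at $(q_e,0)$, is positive elsewhere, and has derivative $0$ along the Birkhoffian vector field, and its level sets there for all small values $c>0$ are closed hypersurfaces around $(q_e,0)$ (compact, and met in exactly one point by every ray from $(q_e,0)$). If $m=1$, all motions that start near $(q_e,0)$ are periodic. There may be several equilibria: there is a network with three nodes, one inductor, two capacitors and $m=1$, with nowhere vanishing $L_a$ and $C_\alpha$ and a regular Birkhoffian, that has at least two equilibrium points which satisfy all the hypotheses of 3. -/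

import Mathlib

open scoped ContDiff

noncomputable section

/-! ### Birkhoffians in global coordinates

The configuration spaces of networks are affine spaces, so a single global chart is enough:
positions `q`, velocities `v` and accelerations `w` are vectors of `Fin m → ℝ`. -/

/-- Positions (or velocities, or accelerations) in coordinates. -/
abbrev Coord (m : ℕ) : Type := Fin m → ℝ

/-- States `(q, v)`: the tangent bundle of the configuration space, in coordinates. -/
abbrev Phase (m : ℕ) : Type := Coord m × Coord m

/-- The components `Q_j(q, v, w)` of a Birkhoffian `∑ j, Q_j dq^j`. -/
abbrev Birkhoffian (m : ℕ) : Type := Coord m → Coord m → Coord m → Fin m → ℝ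

namespace Birkhoffian

variable {m : ℕ}

/-- Regularity: `det [∂Q_j/∂w^i] ≠ 0` at every `(q, v, w)`, and above every `(q, v)` there is
a point of the differential system `Q = 0`. -/
def IsRegular (Q : Birkhoffian m) : Prop :=
  (∀ q v w : Coord m,
    (Matrix.of fun j i : Fin m =>
      fderiv ℝ (fun w' : Coord m => Q q v w' j) w (Pi.single i 1)).det ≠ 0) ∧
  ∀ q v : Coord m, ∃ w : Coord m, ∀ j, Q q v w j = 0

/-- `(qe, 0)` is an equilibrium point: the system can remain at rest at `qe`. -/
def IsEquilibrium (Q : Birkhoffian m) (qe : Coord m) : Prop :=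
  ∀ j, Q qe 0 0 j = 0

/-- `γ = (q, q̇)` is a motion on the set of times `I`: `dq/dt` is the second component of `γ`
and `Q(q, q̇, q̈) = 0`. -/
def IsMotionOn (Q : Birkhoffian m) (γ : ℝ → Phase m) (I : Set ℝ) : Prop :=
  ∀ t ∈ I, ∃ w : Coord m,
    HasDerivWithinAt γ ((γ t).2, w) I t ∧ ∀ j, Q (γ t).1 (γ t).2 w j = 0

/-- `Q` is conservative with energy `E`: `∑ Q_j v^j = ∑ (∂E/∂q^j) v^j + ∑ (∂E/∂v^j) w^j`
identically in `(q, v, w)`. -/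
def IsConservativeWith (Q : Birkhoffian m) (E : Phase m → ℝ) : Prop :=
  ContDiff ℝ ∞ E ∧
    ∀ q v w : Coord m, ∑ j, Q q v w j * v j = fderiv ℝ E (q, v) (v, w)

/-- Liapunov stability of `(qe, 0)`: for every open neighbourhood `Ω` there is an open
neighbourhood `Ω₁ ⊆ Ω` such that from every state of `Ω₁` there starts a motion for all
`t ≥ 0`, and every motion (however long) that starts in `Ω₁` remains in `Ω`. -/
def IsStable (Q : Birkhoffian m) (qe : Coord m) : Prop :=
  ∀ Ω : Set (Phase m), IsOpen Ω → (qe, (0 : Coord m)) ∈ Ω →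
    ∃ Ω₁ : Set (Phase m), IsOpen Ω₁ ∧ (qe, (0 : Coord m)) ∈ Ω₁ ∧ Ω₁ ⊆ Ω ∧
      ∀ z ∈ Ω₁,
        (∃ γ : ℝ → Phase m, Q.IsMotionOn γ (Set.Ici 0) ∧ γ 0 = z) ∧
        ∀ (T : ℝ) (γ : ℝ → Phase m), Q.IsMotionOn γ (Set.Ico 0 T) → γ 0 = z →
          ∀ t ∈ Set.Ico 0 T, γ t ∈ Ω

/-- `V` is a Liapunov function for `(qe, 0)` on the open neighbourhood `Ω`. The derivative in
the last clause is the derivative of `V` along the Birkhoffian vector field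
`(q, v) ↦ (v, w)`, where `w` solves `Q(q, v, w) = 0`. -/
structure IsLiapunovFunction (Q : Birkhoffian m) (qe : Coord m) (V : Phase m → ℝ)
    (Ω : Set (Phase m)) : Prop where
  isOpen : IsOpen Ω
  mem : (qe, (0 : Coord m)) ∈ Ω
  contDiff : ContDiff ℝ 1 V
  eq_zero : V (qe, 0) = 0
  pos : ∀ z ∈ Ω, z ≠ (qe, 0) → 0 < V z
  deriv_nonpos : ∀ q v w : Coord m, (q, v) ∈ Ω → (∀ j, Q q v w j = 0) →
    fderiv ℝ V (q, v) (v, w) ≤ 0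

/-- `(qe, 0)` is a center, as witnessed by `V`: near `(qe, 0)`, `V` is a Liapunov function
whose derivative along the Birkhoffian vector field vanishes, and the motions therefore
run on its level sets, which for small values `c > 0` are closed hypersurfaces around
`(qe, 0)`: compact, and met in exactly one point by every ray that starts at `(qe, 0)`. -/
def IsCenterWith (Q : Birkhoffian m) (qe : Coord m) (V : Phase m → ℝ) : Prop :=
  ∃ Ω : Set (Phase m), Q.IsLiapunovFunction qe V Ω ∧
    (∀ q v w : Coord m, (q, v) ∈ Ω → (∀ j, Q q v w j = 0) →
      fderiv ℝ V (q, v) (v, w) = 0) ∧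
    ∃ c₀ : ℝ, 0 < c₀ ∧ ∀ c : ℝ, 0 < c → c ≤ c₀ →
      IsCompact {z ∈ Ω | V z = c} ∧
      ∀ u : Phase m, u ≠ 0 →
        ∃! s : ℝ, 0 < s ∧ (qe, (0 : Coord m)) + s • u ∈ {z ∈ Ω | V z = c}

/-- All motions that start near `(qe, 0)` are periodic. -/
def HasPeriodicMotionsNear (Q : Birkhoffian m) (qe : Coord m) : Prop :=
  ∃ Ω₁ : Set (Phase m), IsOpen Ω₁ ∧ (qe, (0 : Coord m)) ∈ Ω₁ ∧
    ∀ γ : ℝ → Phase m, Q.IsMotionOn γ (Set.Ici 0) → γ 0 ∈ Ω₁ →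
      ∃ T : ℝ, 0 < T ∧ ∀ t : ℝ, 0 ≤ t → γ (t + T) = γ t

end Birkhoffian

/-- The coordinate directions of the state space, velocities first. -/
def phaseBasis {m : ℕ} : Fin m ⊕ Fin m → Phase m
  | Sum.inl i => (0, Pi.single i 1)
  | Sum.inr i => (Pi.single i 1, 0)

/-- The Hessian matrix of second partial derivatives of `V` at `z`, velocities first. -/
def phaseHessian {m : ℕ} (V : Phase m → ℝ) (z : Phase m) :
    Matrix (Fin m ⊕ Fin m) (Fin m ⊕ Fin m) ℝ :=
  Matrix.of fun i j =>
    fderiv ℝ (fun z' => fderiv ℝ V z' (phaseBasis j)) z (phaseBasis i)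

/-- The iterated integral `∫ ⋯ ∫ f dq^{i₁} ⋯ dq^{iₗ}` along a list of indices; every
antiderivative is the one that starts at `0`, and the other variables are kept fixed. -/
def iteratedIntegral {m : ℕ} : List (Fin m) → (Coord m → ℝ) → Coord m → ℝ
  | [], f => f
  | i :: is, f => fun q => ∫ t in (0 : ℝ)..q i, iteratedIntegral is f (Function.update q i t)

/-- A nonlinear LC network with `n + 1` nodes, `k` inductors and `p` capacitors: an oriented
connected graph (parallel branches allowed), one device on every branch, with smooth
characteristics `v_a = L_a(i_a) di_a/dt` of the inductors and `v_α = C_α(q_α)` of the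
capacitors. -/
structure LCNetwork (n k p : ℕ) where
  /-- the node at which a branch starts -/
  src : Fin k ⊕ Fin p → Fin (n + 1)
  /-- the node at which a branch ends -/
  tgt : Fin k ⊕ Fin p → Fin (n + 1)
  connected : ∀ x y, Relation.EqvGen (fun x y => ∃ e, src e = x ∧ tgt e = y) x y
  /-- the reference node -/
  ref : Fin (n + 1)
  L : Fin k → ℝ → ℝ
  C : Fin p → ℝ → ℝ
  smooth_L : ∀ a, ContDiff ℝ ∞ (L a)
  smooth_C : ∀ α, ContDiff ℝ ∞ (C α)

namespace LCNetwork

variable {n k p : ℕ}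

/-- The incidence matrix, without the column of the reference node: `1` if the branch leaves
the node, `-1` if it enters it. -/
def incidence (net : LCNetwork n k p) :
    Matrix (Fin k ⊕ Fin p) {x : Fin (n + 1) // x ≠ net.ref} ℝ :=
  Matrix.of fun e x => (if net.src e = x then 1 else 0) - (if net.tgt e = x then 1 else 0)

/-- The configuration space `{x | Bᵀ x = c}`: the charges allowed by the integrated
Kirchhoff current law. -/
def configSpace (net : LCNetwork n k p) (c : {x : Fin (n + 1) // x ≠ net.ref} → ℝ) :
    Set (Fin k ⊕ Fin p → ℝ) :=
  {x | net.incidence.transpose.mulVec x = c}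

/-- No loop consists of inductors only: no nonzero solution of the Kirchhoff current law
is supported on the inductor branches. -/
def NoInductorLoop (net : LCNetwork n k p) : Prop :=
  ∀ x : Fin k ⊕ Fin p → ℝ, net.incidence.transpose.mulVec x = 0 →
    (∀ α, x (Sum.inr α) = 0) → x = 0

/-- Coordinates `q ↦ x = N q + K` on the configuration space. -/
structure Coordinates (net : LCNetwork n k p)
    (c : {x : Fin (n + 1) // x ≠ net.ref} → ℝ) (m : ℕ) where
  N : Matrix (Fin k ⊕ Fin p) (Fin m) ℝ
  K : Fin k ⊕ Fin p → ℝ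
  injective : Function.Injective N.mulVec
  range_eq : Set.range (fun q => N.mulVec q + K) = net.configSpace c

namespace Coordinates

variable {net : LCNetwork n k p} {c : {x : Fin (n + 1) // x ≠ net.ref} → ℝ} {m : ℕ}

/-- The current `∑ l, N^a_l v^l` through the inductor `a`. -/
def current (X : net.Coordinates c m) (a : Fin k) (v : Coord m) : ℝ :=
  ∑ l, X.N (Sum.inl a) l * v l

/-- The charge `∑ l, N^α_l q^l + K^α` of the capacitor `α`. -/
def charge (X : net.Coordinates c m) (α : Fin p) (q : Coord m) : ℝ :=
  (∑ l, X.N (Sum.inr α) l * q l) + X.K (Sum.inr α)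

/-- The Birkhoffian of the network: `Nᵀ` applied to the vector of voltages. -/
def birkhoffian (X : net.Coordinates c m) : Birkhoffian m := fun q v w j =>
  (∑ a, X.N (Sum.inl a) j * net.L a (X.current a v) * (∑ i, X.N (Sum.inl a) i * w i)) +
  ∑ α, X.N (Sum.inr α) j * net.C α (X.charge α q)

/-- The inductance matrix `[∑ a, N^a_j N^a_i L_a(N^a v)]`. -/
def inductanceMatrix (X : net.Coordinates c m) (v : Coord m) : Matrix (Fin m) (Fin m) ℝ :=
  Matrix.of fun j i =>
    ∑ a, X.N (Sum.inl a) j * X.N (Sum.inl a) i * net.L a (X.current a v)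

/-- The matrix `[∑ α, N^α_j N^α_i C_α'(N^α q + K^α)]`. -/
def capacitanceMatrix (X : net.Coordinates c m) (q : Coord m) : Matrix (Fin m) (Fin m) ℝ :=
  Matrix.of fun j i =>
    ∑ α, X.N (Sum.inr α) j * X.N (Sum.inr α) i * deriv (net.C α) (X.charge α q)

/-- The energy of the inductors: the sum over `a`, `1 ≤ l ≤ m` and `i₁ < ⋯ < iₗ` of
`(-1)^(l+1)` times the iterated integral of
`[L_a^(l-1) (∑ i, N^a_i v^i) + (l-1) L_a^(l-2)] N^a_{i₁} ⋯ N^a_{iₗ}`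
(for `l = 1` the second term in the bracket is `0`). -/
def inductorEnergy (X : net.Coordinates c m) (v : Coord m) : ℝ :=
  ∑ a, ∑ l ∈ Finset.Icc 1 m, ∑ s ∈ Finset.powersetCard l (Finset.univ : Finset (Fin m)),
    (-1) ^ (l + 1) * iteratedIntegral (s.sort (· ≤ ·))
      (fun u => (iteratedDeriv (l - 1) (net.L a) (X.current a u) * X.current a u +
          ((l : ℝ) - 1) * iteratedDeriv (l - 2) (net.L a) (X.current a u)) *
        ∏ i ∈ s, X.N (Sum.inl a) i) v

/-- The energy of the capacitors: the sum over `α`, `1 ≤ l ≤ m` and `i₁ < ⋯ < iₗ` of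
`(-1)^(l+1)` times the iterated integral of `C_α^(l-1) N^α_{i₁} ⋯ N^α_{iₗ}`. -/
def capacitorEnergy (X : net.Coordinates c m) (q : Coord m) : ℝ :=
  ∑ α, ∑ l ∈ Finset.Icc 1 m, ∑ s ∈ Finset.powersetCard l (Finset.univ : Finset (Fin m)),
    (-1) ^ (l + 1) * iteratedIntegral (s.sort (· ≤ ·))
      (fun u => iteratedDeriv (l - 1) (net.C α) (X.charge α u) *
        ∏ i ∈ s, X.N (Sum.inr α) i) q

/-- The energy of the network. -/
def energy (X : net.Coordinates c m) (z : Phase m) : ℝ :=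
  X.inductorEnergy z.2 + X.capacitorEnergy z.1

/-- The energy relative to an equilibrium. -/
def liapunov (X : net.Coordinates c m) (qe : Coord m) (z : Phase m) : ℝ :=
  X.energy z - X.energy (qe, 0)

end Coordinates

end LCNetwork

end

/-! Each integrand of the energy is a mixed partial derivative of a function of one affine form: the
bracket in `L_a` is the `l`-th derivative of an antiderivative of `L_a(x) x`. Integrating it from
`0` in `l` variables gives an alternating sum of values at points with some coordinates replaced by
`0`, and the signed sum over all nonempty index sets collapses by Möbius inversion. Up to a
constant, the energy is therefore the sum of the antiderivatives of `L_a(x) x` and of `C_α` at the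
currents and charges (`energy_eq`). Smoothness, conservation and the Hessian then follow from the
chain rule.

The Birkhoffian is affine in the accelerations with the inductance matrix as coefficient. Regularity
is thus invertibility of this matrix, and the motions are the integral curves of a `C¹` vector field
with the energy as first integral.

Near the equilibrium the radial derivative of `V` is `∑ L_a x_a² + ∑ (C_α(y) - C_α(y_e)) (y - y_e)`.
It is positive: invertibility of the inductance matrix makes every nonzero direction visible to some
inductor, and the absence of inductor loops makes it visible to some capacitor
(`fderiv_liapunov_radial_pos`). So `V` increases strictly along rays. Its positive minimum on a
small sphere is a barrier that low-energy motions cannot cross, which yields stability and existence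
for all times, and each ray meets a low level set once.

For `m = 1`, the motions on a level set rotate with angular velocity bounded away from `0`, so they
return to the line `q = qe` again and again. A level set has at most two points on this line; two of
three returns coincide, and uniqueness makes the motion periodic. -/

/-! ### Iterated integrals and Möbius inversion -/

/-- The antiderivative of `f` that vanishes at `0`. -/
noncomputable def antideriv (f : ℝ → ℝ) (x : ℝ) : ℝ := ∫ t in (0 : ℝ)..x, f t

theorem hasDerivAt_antideriv {f : ℝ → ℝ} (hf : Continuous f) (x : ℝ) :
    HasDerivAt (antideriv f) (f x) x :=
  intervalIntegral.integral_hasDerivAt_right (hf.intervalIntegrable _ _)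
    (hf.stronglyMeasurableAtFilter _ _) hf.continuousAt

theorem deriv_antideriv {f : ℝ → ℝ} (hf : Continuous f) : deriv (antideriv f) = f :=
  funext fun x => (hasDerivAt_antideriv hf x).deriv

theorem contDiff_antideriv {f : ℝ → ℝ} (hf : ContDiff ℝ ∞ f) : ContDiff ℝ ∞ (antideriv f) := by
  rw [contDiff_infty_iff_deriv, deriv_antideriv hf.continuous]
  exact ⟨fun x => (hasDerivAt_antideriv hf.continuous x).differentiableAt, hf⟩

/-- Leibniz' rule, in the shape of the bracket of the inductor energy. For `n = 0` the truncated
index `n - 1` is harmless because its coefficient is `0`. -/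
theorem iteratedDeriv_mul_id {f : ℝ → ℝ} (hf : ContDiff ℝ ∞ f) (n : ℕ) :
    iteratedDeriv n (fun x => f x * x) =
      fun x => iteratedDeriv n f x * x + (n : ℝ) * iteratedDeriv (n - 1) f x := by
  have hd (k : ℕ) (x : ℝ) : HasDerivAt (iteratedDeriv k f) (iteratedDeriv (k + 1) f x) x := by
    rw [iteratedDeriv_succ]
    exact (hf.differentiable_iteratedDeriv k (by exact_mod_cast WithTop.coe_lt_top _) x).hasDerivAt
  induction n with
  | zero => simp
  | succ n ih =>
    rw [iteratedDeriv_succ, ih]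
    funext x
    rcases n with _ | n
    · refine (((hd 0 x).mul (hasDerivAt_id x)).add
        ((hd 0 x).const_mul ((0 : ℕ) : ℝ))).deriv.trans ?_
      simp
    · refine (((hd (n + 1) x).mul (hasDerivAt_id x)).add
        ((hd n x).const_mul ((n + 1 : ℕ) : ℝ))).deriv.trans ?_
      simp only [id, Nat.add_sub_cancel]
      push_cast
      ring

/-- The coordinates in `T` replaced by `0`. -/
def zeroOn {m : ℕ} (T : Finset (Fin m)) (q : Coord m) : Coord m := fun i => if i ∈ T then 0 else q i

theorem zeroOn_empty {m : ℕ} (q : Coord m) : zeroOn ∅ q = q := by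
  funext i
  simp [zeroOn]

theorem zeroOn_univ {m : ℕ} (q : Coord m) : zeroOn Finset.univ q = 0 := by
  funext i
  simp [zeroOn]

theorem zeroOn_insert {m : ℕ} (T : Finset (Fin m)) (i : Fin m) (q : Coord m) :
    zeroOn T (Function.update q i 0) = zeroOn (insert i T) q := by
  funext j
  by_cases hj : j = i
  · subst hj; simp [zeroOn]
  · simp [zeroOn, hj]

theorem hasDerivAt_affine_zeroOn_update {m : ℕ} {T : Finset (Fin m)} {i : Fin m} (hi : i ∉ T)
    (N : Coord m) (K : ℝ) (q : Coord m) (t : ℝ) :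
    HasDerivAt (fun t => (∑ j, N j * zeroOn T (Function.update q i t) j) + K) (N i) t := by
  have h : ∀ j ∈ Finset.univ, HasDerivAt (fun t => N j * zeroOn T (Function.update q i t) j)
      (if j = i then N i else 0) t := by
    intro j _
    by_cases hj : j = i
    · subst hj
      simpa [zeroOn, hi] using (hasDerivAt_id t).const_mul (N j)
    · simpa [zeroOn, hj] using hasDerivAt_const t (N j * zeroOn T q j)
  simpa using (HasDerivAt.fun_sum h).add_const K

/-- Integrating the mixed partial derivative of `φ (∑ j, N j q^j + K)` gives an alternating sum
of values of this function. -/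
theorem iteratedIntegral_iteratedDeriv {m : ℕ} (N : Coord m) (K : ℝ) {l : List (Fin m)}
    (hl : l.Nodup) {φ : ℝ → ℝ} (hφ : ContDiff ℝ ∞ φ) (q : Coord m) :
    iteratedIntegral l (fun u => iteratedDeriv l.length φ ((∑ j, N j * u j) + K) *
        ∏ i ∈ l.toFinset, N i) q =
      ∑ T ∈ l.toFinset.powerset, (-1) ^ T.card * φ ((∑ j, N j * zeroOn T q j) + K) := by
  induction l generalizing φ q with
  | nil => simp [iteratedIntegral, zeroOn_empty]
  | cons i is ih =>
    obtain ⟨hi, his⟩ := List.nodup_cons.1 hl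
    have hi' : i ∉ is.toFinset := by simpa using hi
    have hφ' : ContDiff ℝ ∞ (deriv φ) := (contDiff_infty_iff_deriv.1 hφ).2
    -- The chain rule factor `N i` is absorbed into the function, so that the induction hypothesis
    -- applies to `N i * φ'` and the remaining indices.
    have hfun : (fun u : Coord m => iteratedDeriv (i :: is).length φ ((∑ j, N j * u j) + K) *
        ∏ j ∈ (i :: is).toFinset, N j) =
        fun u => iteratedDeriv is.length (fun x => N i * deriv φ x) ((∑ j, N j * u j) + K) *
          ∏ j ∈ is.toFinset, N j := by
      funext u
      rw [iteratedDeriv_const_mul_field, List.length_cons, iteratedDeriv_succ',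
        List.toFinset_cons, Finset.prod_insert hi']
      ring
    rw [hfun]
    simp only [iteratedIntegral]
    simp_rw [ih his (contDiff_const.mul hφ')]
    have hcont (T : Finset (Fin m)) :
        Continuous fun t => (∑ j, N j * zeroOn T (Function.update q i t) j) + K := by
      refine (continuous_finsetSum _ fun j _ => continuous_const.mul ?_).add continuous_const
      unfold zeroOn
      split_ifs
      · exact continuous_const
      · exact (continuous_apply (A := fun _ : Fin m => ℝ) j).comp
          (continuous_const.update i continuous_id)
    have hint (T : Finset (Fin m)) : Continuous fun t => (-1 : ℝ) ^ T.card *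
        (N i * deriv φ ((∑ j, N j * zeroOn T (Function.update q i t) j) + K)) :=
      continuous_const.mul (continuous_const.mul (hφ'.continuous.comp (hcont T)))
    rw [intervalIntegral.integral_finsetSum fun T _ => (hint T).intervalIntegrable _ _,
      List.toFinset_cons, Finset.sum_powerset_insert hi', ← Finset.sum_add_distrib]
    refine Finset.sum_congr rfl fun T hT => ?_
    have hiT : i ∉ T := fun h => hi' (Finset.mem_powerset.1 hT h)
    have hd (t : ℝ) : HasDerivAt (fun t => (-1 : ℝ) ^ T.card *
        φ ((∑ j, N j * zeroOn T (Function.update q i t) j) + K))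
        ((-1 : ℝ) ^ T.card *
          (N i * deriv φ ((∑ j, N j * zeroOn T (Function.update q i t) j) + K))) t := by
      have h1 := ((hφ.differentiable (by simp))
        ((∑ j, N j * zeroOn T (Function.update q i t) j) + K)).hasDerivAt.comp t
        (hasDerivAt_affine_zeroOn_update hiT N K q t)
      rw [mul_comm (N i)]
      exact h1.const_mul _
    -- The upper limit keeps `T`; the lower limit adds `i` to `T` and contributes a sign. These are
    -- the two halves of the powerset of the longer list.
    rw [intervalIntegral.integral_eq_sub_of_hasDerivAt (fun t _ => hd t)
      ((hint T).intervalIntegrable _ _), Function.update_eq_self, zeroOn_insert,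
      Finset.card_insert_of_notMem hiT, pow_succ]
    ring

/-- Möbius inversion on the subsets of a finite set. -/
theorem sum_powerset_neg_one_pow_sum_powerset {ι : Type*} [DecidableEq ι] (U : Finset ι)
    (a : Finset ι → ℝ) :
    ∑ s ∈ U.powerset, (-1 : ℝ) ^ s.card * ∑ T ∈ s.powerset, (-1 : ℝ) ^ T.card * a T = a U := by
  induction U using Finset.induction_on generalizing a with
  | empty => simp
  | insert i U hi ih =>
    rw [Finset.sum_powerset_insert hi, ← Finset.sum_add_distrib]
    -- The terms of `s` and `insert i s` have opposite signs, so the inner sums over sets without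
    -- `i` cancel. What remains is the same expression for `T ↦ a (insert i T)`.
    refine Eq.trans ?_ (ih fun T => a (insert i T))
    refine Finset.sum_congr rfl fun s hs => ?_
    have his : i ∉ s := fun h => hi (Finset.mem_powerset.1 hs h)
    rw [Finset.sum_powerset_insert his, Finset.card_insert_of_notMem his]
    have h : ∑ T ∈ s.powerset, (-1 : ℝ) ^ (insert i T).card * a (insert i T) =
        -∑ T ∈ s.powerset, (-1 : ℝ) ^ T.card * a (insert i T) := by
      rw [← Finset.sum_neg_distrib]
      refine Finset.sum_congr rfl fun T hT => ?_
      rw [Finset.card_insert_of_notMem fun h => his (Finset.mem_powerset.1 hT h), pow_succ]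
      ring
    rw [h, pow_succ]
    ring

/-- The alternating sum of all iterated integrals recovers the function up to its value at `0`. -/
theorem sum_iteratedIntegral_iteratedDeriv {m : ℕ} (N : Coord m) (K : ℝ) {φ : ℝ → ℝ}
    (hφ : ContDiff ℝ ∞ φ) (q : Coord m) :
    ∑ l ∈ Finset.Icc 1 m, ∑ s ∈ Finset.powersetCard l (Finset.univ : Finset (Fin m)),
      (-1 : ℝ) ^ (l + 1) * iteratedIntegral (s.sort (· ≤ ·))
        (fun u => iteratedDeriv l φ ((∑ j, N j * u j) + K) * ∏ i ∈ s, N i) q =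
      φ ((∑ j, N j * q j) + K) - φ K := by
  set a : Finset (Fin m) → ℝ := fun T => φ ((∑ j, N j * zeroOn T q j) + K) with ha
  have h1 : ∀ l ∈ Finset.Icc 1 m, ∀ s ∈ Finset.powersetCard l (Finset.univ : Finset (Fin m)),
      (-1 : ℝ) ^ (l + 1) * iteratedIntegral (s.sort (· ≤ ·))
        (fun u => iteratedDeriv l φ ((∑ j, N j * u j) + K) * ∏ i ∈ s, N i) q =
      -((-1 : ℝ) ^ s.card * ∑ T ∈ s.powerset, (-1 : ℝ) ^ T.card * a T) := by
    intro l _ s hs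
    obtain rfl := (Finset.mem_powersetCard.1 hs).2
    have h := iteratedIntegral_iteratedDeriv N K (s.sort_nodup (· ≤ ·)) hφ q
    rw [Finset.length_sort, Finset.sort_toFinset] at h
    rw [h, pow_succ]
    ring
  rw [Finset.sum_congr rfl fun l hl => Finset.sum_congr rfl (h1 l hl)]
  -- Möbius inversion includes the empty index set, which the energy omits. Its term is `a ∅`, so
  -- the sum in question is `-(a univ - a ∅)`.
  have h2 := sum_powerset_neg_one_pow_sum_powerset (Finset.univ : Finset (Fin m)) a
  rw [Finset.sum_powerset, Finset.card_univ, Fintype.card_fin, Finset.sum_range_succ',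
    Finset.powersetCard_zero, Finset.sum_singleton] at h2
  have h3 : Finset.Icc 1 m = (Finset.range m).map (addRightEmbedding 1) := by
    ext l
    simp only [Finset.mem_Icc, Finset.mem_map, Finset.mem_range, addRightEmbedding_apply]
    exact ⟨fun h => ⟨l - 1, by omega, by omega⟩, by rintro ⟨k, hk, rfl⟩; omega⟩
  rw [h3, Finset.sum_map]
  simp only [addRightEmbedding_apply, Finset.sum_neg_distrib]
  have h4 : a ∅ = φ ((∑ j, N j * q j) + K) := by simp [ha, zeroOn_empty]
  have h5 : a Finset.univ = φ K := by simp [ha, zeroOn_univ]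
  simp only [Finset.powerset_empty, Finset.sum_singleton, Finset.card_empty, pow_zero, one_mul,
    h4, h5] at h2
  linarith

/-! ### Vector fields with a first integral, rotation, and level sets -/

section Dynamics

open Set Metric
open scoped NNReal

variable {E : Type*} [NormedAddCommGroup E] [NormedSpace ℝ E]

/-- A bounded Lipschitz vector field is complete. -/
theorem exists_solution_of_lipschitz_of_bounded [CompleteSpace E] {g : E → E} {K L : ℝ≥0}
    (hK : LipschitzWith K g) (hL : ∀ x, ‖g x‖ ≤ L) (x : E) :
    ∃ γ : ℝ → E, γ 0 = x ∧ ∀ t, HasDerivAt γ (g (γ t)) t := by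
  have hex (n : ℕ) : ∃ α : ℝ → E, α 0 = x ∧
      ∀ t ∈ Ioo (-((n : ℝ) + 1)) (n + 1), HasDerivAt α (g (α t)) t := by
    have h0 : (0 : ℝ) ∈ Icc (-((n : ℝ) + 1)) (n + 1) := by
      constructor <;> linarith [n.cast_nonneg (α := ℝ)]
    -- Within time `n + 1` a field bounded by `L` moves a point by at most `L * (n + 1)`, so a
    -- single Picard–Lindelöf ball covers the whole interval.
    have hp : IsPicardLindelof (fun _ => g) (⟨0, h0⟩ : Icc (-((n : ℝ) + 1)) (n + 1)) x
        (L * (n + 1)) 0 L K :=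
      IsPicardLindelof.of_time_independent (fun y _ => hL y) hK.lipschitzOnWith (by simp)
    obtain ⟨α, h1, h2⟩ := hp.exists_eq_forall_mem_Icc_hasDerivWithinAt₀
    exact ⟨α, h1, fun t ht => (h2 t (Ioo_subset_Icc_self ht)).hasDerivAt (Icc_mem_nhds ht.1 ht.2)⟩
  choose α hα0 hα using hex
  have heq {n k : ℕ} (hnk : n ≤ k) : EqOn (α n) (α k) (Ioo (-((n : ℝ) + 1)) (n + 1)) := by
    have hc : (n : ℝ) ≤ k := by exact_mod_cast hnk
    have hn : (0 : ℝ) ≤ n := n.cast_nonneg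
    refine ODE_solution_unique_of_mem_Ioo (v := fun _ => g) (s := fun _ => univ) (t₀ := 0)
      (fun t _ => hK.lipschitzOnWith) (by constructor <;> linarith)
      (fun t ht => ⟨hα n t ht, mem_univ _⟩)
      (fun t ht => ⟨hα k t ⟨by linarith [ht.1], by linarith [ht.2]⟩, mem_univ _⟩) ?_
    rw [hα0, hα0]
  refine ⟨fun t => α ⌈|t|⌉₊ t, by simp [hα0], fun t => ?_⟩
  have hmem (s : ℝ) : s ∈ Ioo (-((⌈|s|⌉₊ : ℝ) + 1)) (⌈|s|⌉₊ + 1) := by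
    have := Nat.le_ceil |s|
    constructor <;> linarith [neg_abs_le s, le_abs_self s]
  -- With one added to the ceiling, every `s` near `t` has `⌈|s|⌉₊ ≤ n`, and the glued curve
  -- coincides there with the single solution `α n`.
  set n := ⌈|t|⌉₊ + 1 with hn
  have ht : t ∈ Ioo (-(n : ℝ)) n := by
    have := hmem t
    simpa [hn] using this
  have hev : (fun s => α ⌈|s|⌉₊ s) =ᶠ[nhds t] α n := by
    filter_upwards [Ioo_mem_nhds ht.1 ht.2] with s hs
    refine heq (Nat.ceil_le.2 (abs_lt.2 hs).le) (hmem s)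
  have h := (hα n t ⟨by linarith [ht.1], by linarith [ht.2]⟩).congr_of_eventuallyEq hev
  rwa [← hev.eq_of_nhds] at h

/-- A vector field of class `C¹` agrees on a ball with a bounded Lipschitz multiple of itself. -/
theorem exists_lipschitz_smul_eqOn_closedBall [FiniteDimensional ℝ E] {f : E → E}
    (hf : ContDiff ℝ 1 f) (z₀ : E) {r : ℝ} (hr : 0 < r) :
    ∃ (χ : E → ℝ) (K L : ℝ≥0), LipschitzWith K (fun z => χ z • f z) ∧
      (∀ z, ‖χ z • f z‖ ≤ L) ∧ ∀ z ∈ closedBall z₀ r, χ z = 1 := by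
  let χ : ContDiffBump z₀ := ⟨r, r + 1, hr, by linarith⟩
  have hc : HasCompactSupport fun z => χ z • f z := χ.hasCompactSupport.smul_right
  have hg : ContDiff ℝ 1 fun z => χ z • f z := χ.contDiff.smul hf
  obtain ⟨K, hK⟩ := hg.lipschitzWith_of_hasCompactSupport hc one_ne_zero
  obtain ⟨L, hL⟩ := hc.exists_bound_of_continuous hg.continuous
  exact ⟨χ, K, ⟨max L 0, le_max_right _ _⟩, hK, fun z => (hL z).trans (le_max_left _ _),
    fun z hz => χ.one_of_mem_closedBall hz⟩

/-- A first integral of a vector field is constant along its solutions. -/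
theorem eq_of_fderiv_eq_zero_along {V : E → ℝ} (hV : Differentiable ℝ V) {γ γ' : ℝ → E}
    {I : Set ℝ} (hI : I.OrdConnected) (hγ : ∀ t ∈ I, HasDerivWithinAt γ (γ' t) I t)
    (h0 : ∀ t ∈ I, fderiv ℝ V (γ t) (γ' t) = 0) {s t : ℝ} (hs : s ∈ I) (ht : t ∈ I) :
    V (γ s) = V (γ t) := by
  have hd : ∀ t ∈ I, HasDerivWithinAt (fun t => V (γ t)) 0 I t := fun t ht => by
    have h := (hV (γ t)).hasFDerivAt.comp_hasDerivWithinAt t (hγ t ht)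
    rwa [h0 t ht] at h
  have h := hI.convex.norm_image_sub_le_of_norm_hasDerivWithin_le (C := 0) hd (by simp) ht hs
  rw [zero_mul] at h
  exact sub_eq_zero.1 (norm_le_zero_iff.1 h)

/-- A curve on which `V` takes a value below its minimum on a sphere cannot cross the sphere. -/
theorem mem_ball_of_lt_on_sphere {E : Type*} [SeminormedAddCommGroup E] {V : E → ℝ} {z₀ : E}
    {r c : ℝ}
    (hsph : ∀ z ∈ sphere z₀ r, c ≤ V z) {γ : ℝ → E} {I : Set ℝ} (hI : I.OrdConnected)
    (hγ : ContinuousOn γ I) (hc : ∀ t ∈ I, V (γ t) < c) {s t : ℝ} (hs : s ∈ I) (ht : t ∈ I)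
    (hsr : γ s ∈ ball z₀ r) : γ t ∈ ball z₀ r := by
  by_contra hcon
  rw [mem_ball, not_lt] at hcon
  obtain ⟨u, hu, hur⟩ := hI.isPreconnected.intermediate_value hs ht
    ((continuous_id.dist (continuous_const (y := z₀))).comp_continuousOn hγ) ⟨(mem_ball.1 hsr).le, hcon⟩
  exact absurd (hsph _ hur) (not_le.2 (hc u hu))

/-- Solutions that are confined to a ball by a first integral exist for all times. -/
theorem exists_solution_of_lt_on_sphere [FiniteDimensional ℝ E] {f : E → E}
    (hf : ContDiff ℝ 1 f) {V : E → ℝ} (hV : Differentiable ℝ V)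
    (hVf : ∀ z, fderiv ℝ V z (f z) = 0) {z₀ z : E} {r c : ℝ}
    (hsph : ∀ z ∈ sphere z₀ r, c ≤ V z) (hz : z ∈ ball z₀ r) (hzc : V z < c) :
    ∃ γ : ℝ → E, γ 0 = z ∧ ∀ t, HasDerivAt γ (f (γ t)) t := by
  have := FiniteDimensional.complete ℝ E
  obtain ⟨χ, K, L, hK, hL, hχ⟩ :=
    exists_lipschitz_smul_eqOn_closedBall hf z₀ (pos_of_mem_ball hz)
  obtain ⟨γ, h0, hγ⟩ := exists_solution_of_lipschitz_of_bounded hK hL z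
  refine ⟨γ, h0, fun t => ?_⟩
  -- `V` is also a first integral of the truncated field, which is a multiple of `f`. Hence the
  -- complete solution of the truncated field stays in the ball, where the factor `χ` is `1`.
  have hconst (t : ℝ) : V (γ t) = V z := by
    rw [← h0]
    exact eq_of_fderiv_eq_zero_along hV ordConnected_univ
      (fun t _ => (hγ t).hasDerivWithinAt) (fun t _ => by rw [map_smul, hVf, smul_zero])
      (mem_univ t) (mem_univ 0)
  have hb : γ t ∈ ball z₀ r := mem_ball_of_lt_on_sphere hsph ordConnected_univ
    (continuous_iff_continuousAt.2 fun t => (hγ t).continuousAt).continuousOn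
    (fun t _ => (hconst t).trans_lt hzc) (mem_univ 0) (mem_univ t) (by rwa [h0])
  have h := hγ t
  rwa [hχ _ (ball_subset_closedBall hb), one_smul] at h

/-- A solution in a ball that passes twice through the same state is periodic. -/
theorem periodic_of_eq_of_mem_closedBall [FiniteDimensional ℝ E] {f : E → E}
    (hf : ContDiff ℝ 1 f) {z₀ : E} {r : ℝ} (hr : 0 < r) {γ : ℝ → E}
    (hγ : ∀ t ∈ Ici (0 : ℝ), HasDerivWithinAt γ (f (γ t)) (Ici 0) t)
    (hγr : ∀ t ∈ Ici (0 : ℝ), γ t ∈ closedBall z₀ r) {s t : ℝ} (hs : 0 < s) (hst : s < t)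
    (heq : γ s = γ t) {u : ℝ} (hu : 0 ≤ u) : γ (u + (t - s)) = γ u := by
  obtain ⟨χ, K, L, hK, hL, hχ⟩ := exists_lipschitz_smul_eqOn_closedBall hf z₀ hr
  have hlip : LipschitzOnWith K f (closedBall z₀ r) := fun x hx y hy => by
    have h := hK x y
    simpa only [hχ x hx, hχ y hy, one_smul] using h
  have hd : ∀ v, 0 < v → HasDerivAt γ (f (γ v)) v := fun v hv =>
    (hγ v hv.le).hasDerivAt (Ici_mem_nhds hv)
  have hc : ContinuousOn γ (Ici 0) := fun v hv => (hγ v hv).continuousWithinAt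
  have hT : 0 < t - s := sub_pos.2 hst
  -- The shifted and the original solution agree at time `s`. The interval contains `u` and has `s`
  -- in its interior, so uniqueness also runs backwards from `s` to `0`.
  have huniq := ODE_solution_unique_of_mem_Icc (v := fun _ => f) (s := fun _ => closedBall z₀ r)
    (t₀ := s) (a := 0) (b := max u s + 1) (f := fun v => γ (v + (t - s))) (g := γ)
    (fun _ _ => hlip) ⟨hs, (le_max_right u s).trans_lt (lt_add_one _)⟩
    (hc.comp (by fun_prop) fun v hv => add_nonneg hv.1 hT.le)
    (fun v hv => (hd (v + (t - s)) (add_pos hv.1 hT)).comp_add_const v (t - s))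
    (fun v hv => hγr _ (add_nonneg hv.1.le hT.le))
    (hc.mono Icc_subset_Ici_self) (fun v hv => hd v hv.1) (fun v hv => hγr v hv.1.le)
    (by simp [heq])
  exact huniq ⟨hu, (le_max_left u s).trans (lt_add_one _).le⟩

/-- A plane curve that rotates clockwise with angular velocity at least `ε` meets the second
axis. -/
theorem exists_eq_zero_of_rotation {x y w : ℝ → ℝ} {t₀ ε : ℝ} (hε : 0 < ε)
    (hx : ∀ t, t₀ ≤ t → HasDerivAt x (y t) t) (hy : ∀ t, t₀ ≤ t → HasDerivAt y (w t) t)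
    (hrot : ∀ t, t₀ ≤ t → x t * w t - y t ^ 2 ≤ -ε * (x t ^ 2 + y t ^ 2)) :
    ∃ t, t₀ ≤ t ∧ x t = 0 := by
  by_contra! hne
  -- As long as `x` does not vanish, `arctan (y / x)` is a continuous angle that decreases at rate
  -- at least `ε`. It would drop by `π` in time `π / ε`, but its range is an open interval of length
  -- `π`.
  have hd : ∀ t ∈ Ici t₀, HasDerivWithinAt (fun t => Real.arctan (y t / x t) + ε * t)
      (1 / (1 + (y t / x t) ^ 2) * ((w t * x t - y t * y t) / x t ^ 2) + ε * 1) (Ici t₀) t :=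
    fun t ht => ((((hy t ht).div (hx t ht) (hne t ht)).arctan).add
      ((hasDerivAt_id t).const_mul ε)).hasDerivWithinAt
  have hanti : AntitoneOn (fun t => Real.arctan (y t / x t) + ε * t) (Ici t₀) := by
    refine antitoneOn_of_hasDerivWithinAt_nonpos (convex_Ici t₀)
      (fun t ht => (hd t ht).continuousWithinAt)
      (fun t ht => (hd t (interior_subset ht)).mono interior_subset) fun t ht => ?_
    have ht' : t₀ ≤ t := interior_subset ht
    have hx2 : 0 < x t ^ 2 := by have := hne t ht'; positivity
    have : 1 / (1 + (y t / x t) ^ 2) * ((w t * x t - y t * y t) / x t ^ 2) =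
        (x t * w t - y t ^ 2) / (x t ^ 2 + y t ^ 2) := by
      have := hne t ht'
      field_simp
    rw [this, mul_one]
    have h := (div_le_iff₀ (by positivity : 0 < x t ^ 2 + y t ^ 2)).2 (hrot t ht')
    linarith
  have hpi : 0 < Real.pi / ε := div_pos Real.pi_pos hε
  have h := hanti (self_mem_Ici (a := t₀)) (show t₀ ≤ t₀ + Real.pi / ε by linarith)
    (by linarith)
  have he : ε * (t₀ + Real.pi / ε) = ε * t₀ + Real.pi := by field_simp
  simp only [he] at h
  linarith [Real.arctan_lt_pi_div_two (y t₀ / x t₀),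
    Real.neg_pi_div_two_lt_arctan (y (t₀ + Real.pi / ε) / x (t₀ + Real.pi / ε))]

/-- If the radial derivative of `V` is positive then `V` increases along rays. -/
theorem strictMonoOn_ray {V : E → ℝ} (hV : Differentiable ℝ V) {z₀ : E} {r : ℝ}
    (hrad : ∀ z ∈ closedBall z₀ r, z ≠ z₀ → 0 < fderiv ℝ V z (z - z₀)) {u : E} (hu : u ≠ 0) :
    StrictMonoOn (fun s : ℝ => V (z₀ + s • u)) (Icc 0 (r / ‖u‖)) := by
  have hd (s : ℝ) : HasDerivAt (fun s : ℝ => V (z₀ + s • u)) (fderiv ℝ V (z₀ + s • u) u) s := by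
    have h := ((hasDerivAt_id s).smul_const u).const_add z₀
    rw [one_smul] at h
    exact (hV _).hasFDerivAt.comp_hasDerivAt s h
  refine strictMonoOn_of_deriv_pos (convex_Icc _ _)
    (fun s _ => (hd s).continuousAt.continuousWithinAt) fun s hs => ?_
  rw [interior_Icc] at hs
  have hu' : 0 < ‖u‖ := norm_pos_iff.2 hu
  have hmem : z₀ + s • u ∈ closedBall z₀ r := by
    rw [mem_closedBall, dist_self_add_left, norm_smul, Real.norm_of_nonneg hs.1.le]
    exact ((lt_div_iff₀ hu').1 hs.2).le
  have h := hrad _ hmem (by simp [hs.1.ne', hu])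
  rw [add_sub_cancel_left, map_smul, smul_eq_mul] at h
  rw [(hd s).deriv]
  exact pos_of_mul_pos_right h hs.1.le

theorem lt_of_mem_closedBall_of_radial {V : E → ℝ} (hV : Differentiable ℝ V) {z₀ : E} {r : ℝ}
    (hrad : ∀ z ∈ closedBall z₀ r, z ≠ z₀ → 0 < fderiv ℝ V z (z - z₀)) {z : E}
    (hz : z ∈ closedBall z₀ r) (hne : z ≠ z₀) : V z₀ < V z := by
  have hu : z - z₀ ≠ 0 := sub_ne_zero.2 hne
  have hle : 1 ≤ r / ‖z - z₀‖ := by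
    rw [le_div_iff₀ (norm_pos_iff.2 hu), one_mul, ← dist_eq_norm]
    exact hz
  have h := strictMonoOn_ray hV hrad hu ⟨le_rfl, zero_le_one.trans hle⟩ ⟨zero_le_one, hle⟩
    zero_lt_one
  simpa using h

theorem exists_pos_le_on_sphere [FiniteDimensional ℝ E] {V : E → ℝ} (hV : Continuous V) {z₀ : E}
    {r : ℝ} (hpos : ∀ z ∈ sphere z₀ r, 0 < V z) : ∃ c, 0 < c ∧ ∀ z ∈ sphere z₀ r, c ≤ V z := by
  have := FiniteDimensional.proper_real E
  rcases (sphere z₀ r).eq_empty_or_nonempty with h | h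
  -- The sphere is empty when the space is trivial, as happens for `m = 0`.
  · exact ⟨1, one_pos, by simp [h]⟩
  · obtain ⟨z, hz, hmin⟩ := (isCompact_sphere z₀ r).exists_isMinOn h hV.continuousOn
    exact ⟨V z, hpos z hz, fun y hy => hmin hy⟩

/-- Since the level is not attained on the sphere, the open ball may be replaced by the closed one.
-/
theorem isCompact_level_of_lt_on_sphere [FiniteDimensional ℝ E] {V : E → ℝ} (hV : Continuous V)
    {z₀ : E} {r c : ℝ} (hsph : ∀ z ∈ sphere z₀ r, c < V z) :
    IsCompact {z ∈ ball z₀ r | V z = c} := by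
  have := FiniteDimensional.proper_real E
  have h : {z ∈ ball z₀ r | V z = c} = closedBall z₀ r ∩ V ⁻¹' {c} := by
    ext z
    refine ⟨fun h => ⟨ball_subset_closedBall h.1, h.2⟩, fun h => ⟨?_, h.2⟩⟩
    refine lt_of_le_of_ne h.1 fun he => (hsph z he).ne' h.2
  rw [h]
  exact (isCompact_closedBall z₀ r).inter_right (isClosed_singleton.preimage hV)

/-- The ray leaves the ball at parameter `r / ‖u‖`. Existence is the intermediate value theorem
between the centre and the sphere; uniqueness is monotonicity along the ray. -/
theorem existsUnique_ray_level {V : E → ℝ} (hV : Differentiable ℝ V) {z₀ : E} {r c : ℝ}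
    (hr : 0 < r) (hrad : ∀ z ∈ closedBall z₀ r, z ≠ z₀ → 0 < fderiv ℝ V z (z - z₀))
    (h0 : V z₀ < c) (hsph : ∀ z ∈ sphere z₀ r, c < V z) {u : E} (hu : u ≠ 0) :
    ∃! s : ℝ, 0 < s ∧ z₀ + s • u ∈ {z ∈ ball z₀ r | V z = c} := by
  have hu' : 0 < ‖u‖ := norm_pos_iff.2 hu
  have hmono := strictMonoOn_ray hV hrad hu
  have hmem {s : ℝ} (hs : 0 < s) : z₀ + s • u ∈ ball z₀ r ↔ s < r / ‖u‖ := by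
    rw [mem_ball, dist_self_add_left, norm_smul, Real.norm_of_nonneg hs.le, lt_div_iff₀ hu']
  have hend : c < V (z₀ + (r / ‖u‖) • u) := by
    refine hsph _ ?_
    rw [mem_sphere, dist_self_add_left, norm_smul, Real.norm_of_nonneg (div_pos hr hu').le,
      div_mul_cancel₀ _ hu'.ne']
  have hcont : Continuous fun s : ℝ => V (z₀ + s • u) :=
    hV.continuous.comp (by fun_prop)
  obtain ⟨s, hs, hsc⟩ := intermediate_value_Ioo (div_pos hr hu').le hcont.continuousOn
    (show c ∈ Ioo _ _ from ⟨by simpa using h0, hend⟩)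
  refine ⟨s, ⟨hs.1, (hmem hs.1).2 hs.2, hsc⟩, fun s' ⟨hs'0, hs'm, hs'c⟩ => ?_⟩
  exact hmono.injOn ⟨hs'0.le, ((hmem hs'0).1 hs'm).le⟩ (Ioo_subset_Icc_self hs)
    (hs'c.trans hsc.symm)

end Dynamics

/-! ### Smoothness of the inverse matrix, and block diagonal positive definiteness -/

theorem contDiff_matrix_det {E ι : Type*} [NormedAddCommGroup E] [NormedSpace ℝ E] [Fintype ι]
    [DecidableEq ι] {d : WithTop ℕ∞} {A : E → Matrix ι ι ℝ}
    (hA : ∀ i j, ContDiff ℝ d fun x => A x i j) : ContDiff ℝ d fun x => (A x).det := by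
  simp_rw [Matrix.det_apply']
  exact ContDiff.sum fun σ _ => contDiff_const.mul (contDiff_prod fun i _ => hA _ _)

theorem contDiff_matrix_inv_apply {E ι : Type*} [NormedAddCommGroup E] [NormedSpace ℝ E]
    [Fintype ι] [DecidableEq ι] {d : WithTop ℕ∞} {A : E → Matrix ι ι ℝ}
    (hA : ∀ i j, ContDiff ℝ d fun x => A x i j) (hdet : ∀ x, (A x).det ≠ 0) (i j : ι) :
    ContDiff ℝ d fun x => (A x)⁻¹ i j := by
  simp_rw [Matrix.inv_def, Matrix.smul_apply, Ring.inverse_eq_inv', smul_eq_mul,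
    Matrix.adjugate_apply]
  refine ((contDiff_matrix_det hA).inv hdet).mul (contDiff_matrix_det fun a b => ?_)
  by_cases h : a = j
  · subst h
    simpa using contDiff_const
  · simpa [Matrix.updateRow_ne h] using hA a b

theorem Matrix.PosDef.fromBlocks_diagonal {ι κ : Type*} [Fintype ι] [Fintype κ]
    {A : Matrix ι ι ℝ} {D : Matrix κ κ ℝ} (hA : A.PosDef) (hD : D.PosDef) :
    (Matrix.fromBlocks A 0 0 D).PosDef := by
  refine .of_dotProduct_mulVec_pos (hA.isHermitian.fromBlocks (by simp) hD.isHermitian)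
    fun x hx => ?_
  have h : star x ⬝ᵥ (Matrix.fromBlocks A 0 0 D).mulVec x =
      star (x ∘ Sum.inl) ⬝ᵥ A.mulVec (x ∘ Sum.inl) +
        star (x ∘ Sum.inr) ⬝ᵥ D.mulVec (x ∘ Sum.inr) := by
    rw [Matrix.fromBlocks_mulVec]
    simp [dotProduct, Fintype.sum_sum_type]
  rw [h]
  by_cases h1 : x ∘ Sum.inl = 0
  · have h2 : x ∘ Sum.inr ≠ 0 := fun h2 => hx <| by
      funext i
      rcases i with i | i
      · exact congrFun h1 i
      · exact congrFun h2 i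
    exact add_pos_of_nonneg_of_pos (hA.posSemidef.dotProduct_mulVec_nonneg _)
      (hD.dotProduct_mulVec_pos h2)
  · exact add_pos_of_pos_of_nonneg (hA.dotProduct_mulVec_pos h1)
      (hD.posSemidef.dotProduct_mulVec_nonneg _)

/-! ### Energy, regularity and vector field of a network -/

namespace LCNetwork.Coordinates

variable {n k p : ℕ} {net : LCNetwork n k p} {c : {x : Fin (n + 1) // x ≠ net.ref} → ℝ} {m : ℕ}
  (X : net.Coordinates c m)

/-- The linear form `∑ l, N^e_l v^l` of the branch `e`. -/
noncomputable def branch (e : Fin k ⊕ Fin p) : Coord m →L[ℝ] ℝ :=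
  ∑ l, X.N e l • ContinuousLinearMap.proj (R := ℝ) (φ := fun _ : Fin m => ℝ) l

theorem branch_apply (e : Fin k ⊕ Fin p) (v : Coord m) : X.branch e v = ∑ l, X.N e l * v l := by
  simp [branch]

theorem branch_single (e : Fin k ⊕ Fin p) (i : Fin m) :
    X.branch e (Pi.single i 1) = X.N e i := by
  simp [branch_apply, Pi.single_apply]

theorem current_eq (a : Fin k) (v : Coord m) : X.current a v = X.branch (Sum.inl a) v := by
  rw [branch_apply, current]

theorem charge_eq (α : Fin p) (q : Coord m) :
    X.charge α q = X.branch (Sum.inr α) q + X.K (Sum.inr α) := by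
  rw [branch_apply, charge]

theorem contDiff_current (a : Fin k) : ContDiff ℝ ∞ (X.current a) := by
  simp_rw [funext (X.current_eq a)]
  exact (X.branch _).contDiff

theorem contDiff_charge (α : Fin p) : ContDiff ℝ ∞ (X.charge α) := by
  simp_rw [funext (X.charge_eq α)]
  exact (X.branch _).contDiff.add contDiff_const

theorem charge_sub_charge (α : Fin p) (q q' : Coord m) :
    X.charge α q - X.charge α q' = X.branch (Sum.inr α) (q - q') := by
  rw [charge_eq, charge_eq, map_sub]
  ring

/-- The energy is the sum of the energies of the devices. -/
theorem energy_eq (z : Phase m) :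
    X.energy z = (∑ a, antideriv (fun x => net.L a x * x) (X.current a z.2)) +
      ∑ α, (antideriv (net.C α) (X.charge α z.1) - antideriv (net.C α) (X.K (Sum.inr α))) := by
  unfold energy inductorEnergy capacitorEnergy
  congr 1
  · refine Finset.sum_congr rfl fun a _ => ?_
    have hL := net.smooth_L a
    -- A current has no constant part, hence the `0` in place of `K`.
    have h := sum_iteratedIntegral_iteratedDeriv (fun j => X.N (Sum.inl a) j) 0
      (contDiff_antideriv (hL.mul contDiff_id)) z.2
    rw [add_zero, show antideriv (fun x => net.L a x * id x) 0 = 0 by simp [antideriv],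
      sub_zero] at h
    refine Eq.trans ?_ h
    refine Finset.sum_congr rfl fun l hl => Finset.sum_congr rfl fun s _ => ?_
    obtain ⟨l, rfl⟩ := Nat.exists_eq_add_of_le' (Finset.mem_Icc.1 hl).1
    rw [iteratedDeriv_succ', deriv_antideriv (hL.mul contDiff_id).continuous]
    simp only [id, iteratedDeriv_mul_id hL, current, add_zero, Nat.add_sub_cancel,
      Nat.cast_add, Nat.cast_one, add_sub_cancel_right, show l + 1 - 2 = l - 1 by omega]
  · refine Finset.sum_congr rfl fun α _ => ?_
    have hC := net.smooth_C α
    refine Eq.trans ?_ (sum_iteratedIntegral_iteratedDeriv (fun j => X.N (Sum.inr α) j)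
      (X.K (Sum.inr α)) (contDiff_antideriv hC) z.1)
    refine Finset.sum_congr rfl fun l hl => Finset.sum_congr rfl fun s _ => ?_
    obtain ⟨l, rfl⟩ := Nat.exists_eq_add_of_le' (Finset.mem_Icc.1 hl).1
    rw [iteratedDeriv_succ', deriv_antideriv hC.continuous]
    simp only [charge, Nat.add_sub_cancel]

theorem contDiff_energy : ContDiff ℝ ∞ X.energy := by
  rw [funext X.energy_eq]
  refine .add (.sum fun a _ => ?_) (.sum fun α _ => .sub ?_ contDiff_const)
  · exact (contDiff_antideriv ((net.smooth_L a).mul contDiff_id)).comp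
      ((X.contDiff_current a).comp contDiff_snd)
  · exact (contDiff_antideriv (net.smooth_C α)).comp ((X.contDiff_charge α).comp contDiff_fst)

theorem fderiv_energy_apply (z u : Phase m) :
    fderiv ℝ X.energy z u =
      (∑ a, net.L a (X.current a z.2) * X.current a z.2 * X.branch (Sum.inl a) u.2) +
        ∑ α, net.C α (X.charge α z.1) * X.branch (Sum.inr α) u.1 := by
  have hL (a : Fin k) : HasFDerivAt
      (fun z : Phase m => antideriv (fun x => net.L a x * x) (X.current a z.2))
      ((net.L a (X.current a z.2) * X.current a z.2) •
        (X.branch (Sum.inl a)).comp (ContinuousLinearMap.snd ℝ (Coord m) (Coord m))) z := by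
    simp_rw [current_eq]
    exact (hasDerivAt_antideriv ((net.smooth_L a).mul contDiff_id).continuous
      _).comp_hasFDerivAt z
      ((X.branch (Sum.inl a)).comp (ContinuousLinearMap.snd ℝ (Coord m) (Coord m))).hasFDerivAt
  have hC (α : Fin p) : HasFDerivAt
      (fun z : Phase m => antideriv (net.C α) (X.charge α z.1) -
        antideriv (net.C α) (X.K (Sum.inr α)))
      (net.C α (X.charge α z.1) •
        (X.branch (Sum.inr α)).comp (ContinuousLinearMap.fst ℝ (Coord m) (Coord m))) z := by
    simp_rw [charge_eq]
    exact ((hasDerivAt_antideriv (net.smooth_C α).continuous _).comp_hasFDerivAt z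
      (((X.branch (Sum.inr α)).comp
        (ContinuousLinearMap.fst ℝ (Coord m) (Coord m))).hasFDerivAt.add_const _)).sub_const _
  have h := (HasFDerivAt.fun_sum fun a (_ : a ∈ Finset.univ) => hL a).add
    (HasFDerivAt.fun_sum fun α (_ : α ∈ Finset.univ) => hC α)
  rw [funext X.energy_eq]
  refine (congrArg (fun A : Phase m →L[ℝ] ℝ => A u) h.fderiv).trans ?_
  simp

/-- The vector of voltages of the capacitors, in coordinates. -/
noncomputable def force (q : Coord m) (j : Fin m) : ℝ := ∑ α, X.N (Sum.inr α) j * net.C α (X.charge α q)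

theorem birkhoffian_eq (q v w : Coord m) (j : Fin m) :
    X.birkhoffian q v w j = (X.inductanceMatrix v).mulVec w j + X.force q j := by
  unfold birkhoffian force
  congr 1
  simp only [inductanceMatrix, Matrix.mulVec, dotProduct, Matrix.of_apply, Finset.sum_mul,
    Finset.mul_sum]
  rw [Finset.sum_comm]
  exact Finset.sum_congr rfl fun i _ => Finset.sum_congr rfl fun a _ => by ring

/-- The direction `u` is left free: `u = v` gives the power balance, and `u = q - qe` gives the sign
of the rotation in one degree of freedom. -/
theorem sum_birkhoffian_mul (q v w u : Coord m) :
    ∑ j, X.birkhoffian q v w j * u j =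
      (∑ a, net.L a (X.current a v) * X.branch (Sum.inl a) w * X.branch (Sum.inl a) u) +
        ∑ α, net.C α (X.charge α q) * X.branch (Sum.inr α) u := by
  simp only [birkhoffian, add_mul, Finset.sum_add_distrib, Finset.sum_mul]
  congr 1
  · rw [Finset.sum_comm]
    refine Finset.sum_congr rfl fun a _ => ?_
    rw [X.branch_apply _ u, Finset.mul_sum]
    exact Finset.sum_congr rfl fun j _ => by rw [branch_apply]; ring
  · rw [Finset.sum_comm]
    refine Finset.sum_congr rfl fun α _ => ?_
    rw [X.branch_apply _ u, Finset.mul_sum]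
    exact Finset.sum_congr rfl fun j _ => by ring

theorem isConservativeWith_energy : X.birkhoffian.IsConservativeWith X.energy := by
  refine ⟨X.contDiff_energy, fun q v w => ?_⟩
  rw [fderiv_energy_apply, sum_birkhoffian_mul]
  congr 1
  exact Finset.sum_congr rfl fun a _ => by simp only [current_eq]; ring

theorem isEquilibrium_iff (qe : Coord m) :
    X.birkhoffian.IsEquilibrium qe ↔ ∀ j, X.force qe j = 0 := by
  unfold Birkhoffian.IsEquilibrium
  simp_rw [birkhoffian_eq, Matrix.mulVec_zero, Pi.zero_apply, zero_add]

/-- The acceleration that the Birkhoffian determines. -/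
noncomputable def accel (q v : Coord m) : Coord m := -((X.inductanceMatrix v)⁻¹.mulVec (X.force q))

theorem birkhoffian_eq_zero_iff {v : Coord m} (hv : (X.inductanceMatrix v).det ≠ 0)
    (q w : Coord m) : (∀ j, X.birkhoffian q v w j = 0) ↔ w = X.accel q v := by
  have hu : IsUnit (X.inductanceMatrix v).det := hv.isUnit
  have h : (∀ j, X.birkhoffian q v w j = 0) ↔ (X.inductanceMatrix v).mulVec w = -X.force q := by
    rw [funext_iff]
    exact forall_congr' fun j => by rw [birkhoffian_eq, Pi.neg_apply, ← eq_neg_iff_add_eq_zero]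
  rw [h]
  constructor
  · intro h
    rw [accel, ← Matrix.mulVec_neg, ← h, Matrix.mulVec_mulVec, Matrix.nonsing_inv_mul _ hu,
      Matrix.one_mulVec]
  · rintro rfl
    rw [accel, Matrix.mulVec_neg, Matrix.mulVec_mulVec, Matrix.mul_nonsing_inv _ hu,
      Matrix.one_mulVec]

/-- The Birkhoffian is affine in `w`, so its Jacobian is the inductance matrix at every `(q, v, w)`.
If that is invertible, the solvability clause of regularity holds automatically, with `accel` as
solution. -/
theorem isRegular_iff :
    X.birkhoffian.IsRegular ↔ ∀ v : Coord m, (X.inductanceMatrix v).det ≠ 0 := by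
  have hmat (q v w : Coord m) : (Matrix.of fun j i : Fin m =>
      fderiv ℝ (fun w' : Coord m => X.birkhoffian q v w' j) w (Pi.single i 1)) =
      X.inductanceMatrix v := by
    ext j i
    have h : HasFDerivAt (fun w' : Coord m => X.birkhoffian q v w' j)
        ((ContinuousLinearMap.proj (R := ℝ) (φ := fun _ : Fin m => ℝ) j).comp
          (Matrix.mulVecLin (X.inductanceMatrix v)).toContinuousLinearMap) w := by
      simp_rw [birkhoffian_eq]
      exact ((ContinuousLinearMap.proj (R := ℝ) (φ := fun _ : Fin m => ℝ) j).comp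
        (Matrix.mulVecLin (X.inductanceMatrix v)).toContinuousLinearMap).hasFDerivAt.add_const _
    rw [Matrix.of_apply, h.fderiv]
    simp
  constructor
  · intro h v
    rw [← hmat 0 v 0]
    exact h.1 0 v 0
  · refine fun h => ⟨fun q v w => by rw [hmat]; exact h v, fun q v => ?_⟩
    exact ⟨X.accel q v, (X.birkhoffian_eq_zero_iff (h v) q _).2 rfl⟩

/-- The Birkhoffian vector field. -/
noncomputable def field (z : Phase m) : Phase m := (z.2, X.accel z.1 z.2)

theorem contDiff_field (hdet : ∀ v, (X.inductanceMatrix v).det ≠ 0) : ContDiff ℝ 1 X.field := by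
  refine contDiff_snd.prodMk (contDiff_pi.2 fun i => ?_)
  have hM (i j : Fin m) : ContDiff ℝ 1 fun z : Phase m => X.inductanceMatrix z.2 i j := by
    change ContDiff ℝ 1 fun z : Phase m =>
      ∑ a, X.N (Sum.inl a) i * X.N (Sum.inl a) j * net.L a (X.current a z.2)
    refine ContDiff.sum fun a _ => contDiff_const.mul ?_
    have h : ContDiff ℝ ∞ fun z : Phase m => net.L a (X.current a z.2) :=
      (net.smooth_L a).comp ((X.contDiff_current a).comp contDiff_snd)
    exact h.of_le (by simp)
  have hF (j : Fin m) : ContDiff ℝ 1 fun z : Phase m => X.force z.1 j := by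
    change ContDiff ℝ 1 fun z : Phase m =>
      ∑ α, X.N (Sum.inr α) j * net.C α (X.charge α z.1)
    refine ContDiff.sum fun α _ => contDiff_const.mul ?_
    have h : ContDiff ℝ ∞ fun z : Phase m => net.C α (X.charge α z.1) :=
      (net.smooth_C α).comp ((X.contDiff_charge α).comp contDiff_fst)
    exact h.of_le (by simp)
  change ContDiff ℝ 1 fun z : Phase m => -∑ j, (X.inductanceMatrix z.2)⁻¹ i j * X.force z.1 j
  exact (ContDiff.sum fun j _ =>
    (contDiff_matrix_inv_apply hM (fun z => hdet z.2) i j).mul (hF j)).neg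

theorem hasDerivWithinAt_of_isMotionOn (hdet : ∀ v, (X.inductanceMatrix v).det ≠ 0)
    {γ : ℝ → Phase m} {I : Set ℝ} (hγ : X.birkhoffian.IsMotionOn γ I) {t : ℝ} (ht : t ∈ I) :
    HasDerivWithinAt γ (X.field (γ t)) I t := by
  obtain ⟨w, hw, h0⟩ := hγ t ht
  rw [X.birkhoffian_eq_zero_iff (hdet _)] at h0
  rwa [h0] at hw

theorem isMotionOn_of_hasDerivAt (hdet : ∀ v, (X.inductanceMatrix v).det ≠ 0)
    {γ : ℝ → Phase m} (hγ : ∀ t, HasDerivAt γ (X.field (γ t)) t) (I : Set ℝ) :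
    X.birkhoffian.IsMotionOn γ I := fun t _ =>
  ⟨_, (hγ t).hasDerivWithinAt, (X.birkhoffian_eq_zero_iff (hdet _) _ _).2 rfl⟩

theorem fderiv_energy_eq_zero {q v w : Coord m} (h : ∀ j, X.birkhoffian q v w j = 0) :
    fderiv ℝ X.energy (q, v) (v, w) = 0 := by
  rw [← X.isConservativeWith_energy.2]
  simp [h]

theorem energy_eq_of_isMotionOn {I : Set ℝ} {γ : ℝ → Phase m} (hI : I.OrdConnected)
    (hγ : X.birkhoffian.IsMotionOn γ I) {s t : ℝ} (hs : s ∈ I) (ht : t ∈ I) :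
    X.energy (γ s) = X.energy (γ t) := by
  choose! w hw h0 using hγ
  exact eq_of_fderiv_eq_zero_along (X.contDiff_energy.differentiable (by simp)) hI hw
    (fun t ht => X.fderiv_energy_eq_zero (h0 t ht)) hs ht

theorem contDiff_liapunov (qe : Coord m) : ContDiff ℝ ∞ (X.liapunov qe) :=
  X.contDiff_energy.sub contDiff_const

theorem differentiable_liapunov (qe : Coord m) : Differentiable ℝ (X.liapunov qe) :=
  (X.contDiff_liapunov qe).differentiable (by simp)

theorem fderiv_liapunov (qe : Coord m) : fderiv ℝ (X.liapunov qe) = fderiv ℝ X.energy :=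
  funext fun _ => fderiv_sub_const _

theorem liapunov_self (qe : Coord m) : X.liapunov qe (qe, 0) = 0 := sub_self _

theorem fderiv_liapunov_field (hdet : ∀ v, (X.inductanceMatrix v).det ≠ 0) (qe : Coord m)
    (z : Phase m) : fderiv ℝ (X.liapunov qe) z (X.field z) = 0 := by
  rw [fderiv_liapunov]
  exact X.fderiv_energy_eq_zero ((X.birkhoffian_eq_zero_iff (hdet _) _ _).2 rfl)

/-! ### The Hessian -/

theorem dotProduct_inductanceMatrix_mulVec (v u : Coord m) :
    u ⬝ᵥ (X.inductanceMatrix v).mulVec u =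
      ∑ a, net.L a (X.current a v) * X.branch (Sum.inl a) u ^ 2 := by
  simp only [dotProduct, Matrix.mulVec, inductanceMatrix, Matrix.of_apply, branch_apply, sq,
    Finset.mul_sum, Finset.sum_mul]
  rw [Finset.sum_comm]
  simp_rw [Finset.sum_comm (s := (Finset.univ : Finset (Fin m)))
    (t := (Finset.univ : Finset (Fin k)))]
  refine Finset.sum_congr rfl fun a _ => ?_
  rw [Finset.sum_comm]
  exact Finset.sum_congr rfl fun i _ => Finset.sum_congr rfl fun j _ => by ring

theorem dotProduct_capacitanceMatrix_mulVec (q u : Coord m) :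
    u ⬝ᵥ (X.capacitanceMatrix q).mulVec u =
      ∑ α, deriv (net.C α) (X.charge α q) * X.branch (Sum.inr α) u ^ 2 := by
  simp only [dotProduct, Matrix.mulVec, capacitanceMatrix, Matrix.of_apply, branch_apply, sq,
    Finset.mul_sum, Finset.sum_mul]
  rw [Finset.sum_comm]
  simp_rw [Finset.sum_comm (s := (Finset.univ : Finset (Fin m)))
    (t := (Finset.univ : Finset (Fin p)))]
  refine Finset.sum_congr rfl fun a _ => ?_
  rw [Finset.sum_comm]
  exact Finset.sum_congr rfl fun i _ => Finset.sum_congr rfl fun j _ => by ring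

/-- A direction that no inductor sees does not change the Birkhoffian when used as acceleration, and
so lies in the kernel of the inductance matrix. -/
theorem exists_branch_inl_ne_zero {v : Coord m} (hv : (X.inductanceMatrix v).det ≠ 0)
    {u : Coord m} (hu : u ≠ 0) : ∃ a, X.branch (Sum.inl a) u ≠ 0 := by
  by_contra! h
  refine hv (Matrix.exists_mulVec_eq_zero_iff.1 ⟨u, hu, ?_⟩)
  funext j
  have h1 := X.birkhoffian_eq 0 v u j
  have h2 := X.birkhoffian_eq 0 v 0 j
  rw [Matrix.mulVec_zero, Pi.zero_apply] at h2
  have h3 : X.birkhoffian 0 v u j = X.birkhoffian 0 v 0 j := by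
    simp [birkhoffian, ← branch_apply, h]
  rw [Pi.zero_apply]
  linarith

/-- As a difference of two points of the configuration space, `N u` satisfies the homogeneous
Kirchhoff law. If no capacitor sees it, it is a current through inductors only, hence `0`, and `N`
is injective. -/
theorem exists_branch_inr_ne_zero (hloop : net.NoInductorLoop) {u : Coord m} (hu : u ≠ 0) :
    ∃ α, X.branch (Sum.inr α) u ≠ 0 := by
  by_contra! h
  have hmem (q : Coord m) : net.incidence.transpose.mulVec (X.N.mulVec q + X.K) = c := by
    have : X.N.mulVec q + X.K ∈ net.configSpace c := X.range_eq ▸ Set.mem_range_self q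
    exact this
  have h1 := hmem u
  have h0 := hmem 0
  rw [Matrix.mulVec_zero, zero_add] at h0
  rw [Matrix.mulVec_add, h0, add_eq_right] at h1
  have h2 := hloop _ h1 fun α => by
    rw [← h α, branch_apply]
    rfl
  exact hu (X.injective (h2.trans (Matrix.mulVec_zero _).symm))

theorem posDef_inductanceMatrix {v : Coord m} (hv : (X.inductanceMatrix v).det ≠ 0)
    (hL : ∀ a, 0 < net.L a (X.current a v)) : (X.inductanceMatrix v).PosDef := by
  refine .of_dotProduct_mulVec_pos ?_ fun u hu => ?_
  · ext i j
    simp only [Matrix.conjTranspose_apply, inductanceMatrix, Matrix.of_apply, star_trivial]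
    exact Finset.sum_congr rfl fun a _ => by ring
  · rw [star_trivial, dotProduct_inductanceMatrix_mulVec]
    obtain ⟨a, ha⟩ := X.exists_branch_inl_ne_zero hv hu
    exact Finset.sum_pos' (fun a _ => mul_nonneg (hL a).le (sq_nonneg _))
      ⟨a, Finset.mem_univ a, mul_pos (hL a) (by positivity)⟩

theorem posDef_capacitanceMatrix (hloop : net.NoInductorLoop) {q : Coord m}
    (hC : ∀ α, 0 < deriv (net.C α) (X.charge α q)) : (X.capacitanceMatrix q).PosDef := by
  refine .of_dotProduct_mulVec_pos ?_ fun u hu => ?_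
  · ext i j
    simp only [Matrix.conjTranspose_apply, capacitanceMatrix, Matrix.of_apply, star_trivial]
    exact Finset.sum_congr rfl fun a _ => by ring
  · rw [star_trivial, dotProduct_capacitanceMatrix_mulVec]
    obtain ⟨α, hα⟩ := X.exists_branch_inr_ne_zero hloop hu
    exact Finset.sum_pos' (fun α _ => mul_nonneg (hC α).le (sq_nonneg _))
      ⟨α, Finset.mem_univ α, mul_pos (hC α) (by positivity)⟩

theorem phaseHessian_liapunov (qe : Coord m) :
    phaseHessian (X.liapunov qe) (qe, 0) =
      Matrix.fromBlocks (X.inductanceMatrix 0) 0 0 (X.capacitanceMatrix qe) := by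
  have hv (j : Fin m) (u : Phase m) :
      fderiv ℝ (fun z : Phase m => fderiv ℝ (X.liapunov qe) z (phaseBasis (Sum.inl j))) (qe, 0) u =
        ∑ a, X.N (Sum.inl a) j * (net.L a 0 * X.branch (Sum.inl a) u.2) := by
    have hf : (fun z : Phase m => fderiv ℝ (X.liapunov qe) z (phaseBasis (Sum.inl j))) =
        fun z => ∑ a, X.N (Sum.inl a) j *
          (net.L a (X.branch (Sum.inl a) z.2) * X.branch (Sum.inl a) z.2) := by
      funext z
      rw [fderiv_liapunov, fderiv_energy_apply]
      simp [phaseBasis, branch_single, current_eq, mul_comm]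
    have hd (a : Fin k) : HasFDerivAt (fun z : Phase m => X.N (Sum.inl a) j *
        (net.L a (X.branch (Sum.inl a) z.2) * X.branch (Sum.inl a) z.2))
        (X.N (Sum.inl a) j • net.L a 0 •
          (X.branch (Sum.inl a)).comp (ContinuousLinearMap.snd ℝ (Coord m) (Coord m))) (qe, 0) := by
      -- The term with `L'` carries the factor `x`, which vanishes at zero velocity.
      have h1 : HasDerivAt (fun x => net.L a x * x) (net.L a 0) (X.branch (Sum.inl a) 0) := by
        have h := ((net.smooth_L a).differentiable (by simp) 0).hasDerivAt.fun_mul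
          (hasDerivAt_id' (0 : ℝ))
        simpa using h
      exact (h1.comp_hasFDerivAt (qe, (0 : Coord m)) ((X.branch (Sum.inl a)).comp
        (ContinuousLinearMap.snd ℝ (Coord m) (Coord m))).hasFDerivAt).const_mul _
    rw [hf, (HasFDerivAt.fun_sum fun a (_ : a ∈ Finset.univ) => hd a).fderiv]
    simp
  have hq (j : Fin m) (u : Phase m) :
      fderiv ℝ (fun z : Phase m => fderiv ℝ (X.liapunov qe) z (phaseBasis (Sum.inr j))) (qe, 0) u =
        ∑ α, X.N (Sum.inr α) j *
          (deriv (net.C α) (X.charge α qe) * X.branch (Sum.inr α) u.1) := by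
    have hf : (fun z : Phase m => fderiv ℝ (X.liapunov qe) z (phaseBasis (Sum.inr j))) =
        fun z => ∑ α, X.N (Sum.inr α) j *
          net.C α (X.branch (Sum.inr α) z.1 + X.K (Sum.inr α)) := by
      funext z
      rw [fderiv_liapunov, fderiv_energy_apply]
      simp [phaseBasis, branch_single, charge_eq, mul_comm]
    have hd (α : Fin p) : HasFDerivAt (fun z : Phase m => X.N (Sum.inr α) j *
        net.C α (X.branch (Sum.inr α) z.1 + X.K (Sum.inr α)))
        (X.N (Sum.inr α) j • deriv (net.C α) (X.charge α qe) •
          (X.branch (Sum.inr α)).comp (ContinuousLinearMap.fst ℝ (Coord m) (Coord m))) (qe, 0) := by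
      have h1 : HasDerivAt (net.C α) (deriv (net.C α) (X.charge α qe))
          (X.branch (Sum.inr α) qe + X.K (Sum.inr α)) := by
        rw [← charge_eq]
        exact (((net.smooth_C α).differentiable (by simp)) _).hasDerivAt
      exact (h1.comp_hasFDerivAt (qe, (0 : Coord m)) (((X.branch (Sum.inr α)).comp
        (ContinuousLinearMap.fst ℝ (Coord m) (Coord m))).hasFDerivAt.add_const _)).const_mul _
    rw [hf, (HasFDerivAt.fun_sum fun α (_ : α ∈ Finset.univ) => hd α).fderiv]
    simp
  ext i j
  rcases j with j | j
  · rw [phaseHessian, Matrix.of_apply, hv]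
    rcases i with i | i
    · simp only [phaseBasis, branch_single, Matrix.fromBlocks_apply₁₁, inductanceMatrix,
        Matrix.of_apply, current_eq, map_zero]
      exact Finset.sum_congr rfl fun a _ => by ring
    · simp [phaseBasis]
  · rw [phaseHessian, Matrix.of_apply, hq]
    rcases i with i | i
    · simp [phaseBasis]
    · simp only [phaseBasis, branch_single, Matrix.fromBlocks_apply₂₂, capacitanceMatrix,
        Matrix.of_apply]
      exact Finset.sum_congr rfl fun α _ => by ring

end LCNetwork.Coordinates

/-! ### Stability, center and periodic motions -/

namespace LCNetwork.Coordinates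

variable {n k p : ℕ} {net : LCNetwork n k p} {c : {x : Fin (n + 1) // x ≠ net.ref} → ℝ} {m : ℕ}
  (X : net.Coordinates c m)

open Set Metric Filter Topology

/-! ### Motions near an equilibrium -/

theorem sum_branch_eq_zero {qe : Coord m} (he : X.birkhoffian.IsEquilibrium qe) (u : Coord m) :
    ∑ α, net.C α (X.charge α qe) * X.branch (Sum.inr α) u = 0 := by
  have h := X.sum_birkhoffian_mul qe 0 0 u
  simp only [he _, zero_mul, Finset.sum_const_zero, map_zero, mul_zero, zero_add] at h
  exact h.symm

/-- The voltages at equilibrium do no work, so they may be subtracted. Each summand then has a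
definite sign where `C_α` is increasing around the equilibrium charge. -/
theorem sum_mul_branch_sub {qe : Coord m} (he : X.birkhoffian.IsEquilibrium qe) (q : Coord m) :
    ∑ α, net.C α (X.charge α q) * X.branch (Sum.inr α) (q - qe) =
      ∑ α, (net.C α (X.charge α q) - net.C α (X.charge α qe)) *
        (X.charge α q - X.charge α qe) := by
  simp_rw [charge_sub_charge, sub_mul, Finset.sum_sub_distrib, X.sum_branch_eq_zero he, sub_zero]

/-- The ball on which the inductances are positive and the voltages of the capacitors
have the sign of the displacement from `qe`. -/
theorem exists_radius_passive (qe : Coord m) (hL : ∀ a, 0 < net.L a 0)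
    (hC : ∀ α, 0 < deriv (net.C α) (X.charge α qe)) {Ω : Set (Phase m)} (hΩ : IsOpen Ω)
    (hmem : (qe, (0 : Coord m)) ∈ Ω) :
    ∃ r : ℝ, 0 < r ∧ closedBall (qe, (0 : Coord m)) r ⊆ Ω ∧
      ∀ z ∈ closedBall (qe, (0 : Coord m)) r, (∀ a, 0 < net.L a (X.current a z.2)) ∧
        ∀ α, X.charge α z.1 ≠ X.charge α qe →
          0 < (net.C α (X.charge α z.1) - net.C α (X.charge α qe)) *
            (X.charge α z.1 - X.charge α qe) := by
  have h1 : ∀ᶠ z in 𝓝 (qe, (0 : Coord m)), ∀ a, 0 < net.L a (X.current a z.2) := by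
    rw [eventually_all]
    intro a
    have hc : Continuous fun z : Phase m => net.L a (X.current a z.2) :=
      (net.smooth_L a).continuous.comp ((X.contDiff_current a).continuous.comp continuous_snd)
    refine hc.continuousAt.eventually (lt_mem_nhds ?_)
    simpa [current_eq] using hL a
  have h2 : ∀ᶠ z in 𝓝 (qe, (0 : Coord m)), ∀ α, X.charge α z.1 ≠ X.charge α qe →
      0 < (net.C α (X.charge α z.1) - net.C α (X.charge α qe)) *
        (X.charge α z.1 - X.charge α qe) := by
    rw [eventually_all]
    intro α
    have hd := ((net.smooth_C α).differentiable (by simp) (X.charge α qe)).hasDerivAt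
    -- Positivity of the derivative at the equilibrium charge alone makes the difference quotients
    -- from this charge positive nearby, which is all that is needed.
    have hs := (hasDerivAt_iff_tendsto_slope.1 hd).eventually (lt_mem_nhds (hC α))
    rw [eventually_nhdsWithin_iff] at hs
    have hc : Continuous fun z : Phase m => X.charge α z.1 :=
      (X.contDiff_charge α).continuous.comp continuous_fst
    filter_upwards [hc.continuousAt.eventually hs] with z hz hne
    have h := hz hne
    rw [slope_def_field] at h
    have hsub := sub_ne_zero.2 hne
    have := mul_pos h (by positivity : 0 < (X.charge α z.1 - X.charge α qe) ^ 2)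
    have he : (net.C α (X.charge α z.1) - net.C α (X.charge α qe)) /
        (X.charge α z.1 - X.charge α qe) * (X.charge α z.1 - X.charge α qe) ^ 2 =
        (net.C α (X.charge α z.1) - net.C α (X.charge α qe)) *
        (X.charge α z.1 - X.charge α qe) := by field_simp
    rwa [he] at this
  obtain ⟨r, hr, h⟩ := nhds_basis_closedBall.mem_iff.1
    (((hΩ.eventually_mem hmem).and (h1.and h2)))
  exact ⟨r, hr, fun z hz => (h hz).1, fun z hz => (h hz).2⟩

theorem sum_capacitor_pos (hloop : net.NoInductorLoop) {q qe : Coord m}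
    (hC : ∀ α, X.charge α q ≠ X.charge α qe →
      0 < (net.C α (X.charge α q) - net.C α (X.charge α qe)) * (X.charge α q - X.charge α qe))
    (hq : q ≠ qe) :
    0 < ∑ α, (net.C α (X.charge α q) - net.C α (X.charge α qe)) *
      (X.charge α q - X.charge α qe) := by
  obtain ⟨α, hα⟩ := X.exists_branch_inr_ne_zero hloop (sub_ne_zero.2 hq)
  rw [← charge_sub_charge, sub_ne_zero] at hα
  refine Finset.sum_pos' (fun β _ => ?_) ⟨α, Finset.mem_univ α, hC α hα⟩
  by_cases h : X.charge β q = X.charge β qe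
  · simp [h]
  · exact (hC β h).le

theorem sum_inductor_pos {v : Coord m} (hv : (X.inductanceMatrix v).det ≠ 0)
    (hL : ∀ a, 0 < net.L a (X.current a v)) {u : Coord m} (hu : u ≠ 0) :
    0 < ∑ a, net.L a (X.current a v) * X.branch (Sum.inl a) u ^ 2 := by
  have h := (X.posDef_inductanceMatrix hv hL).dotProduct_mulVec_pos hu
  rwa [star_trivial, dotProduct_inductanceMatrix_mulVec] at h

/-- The radial derivative of the Liapunov function is positive near the equilibrium. -/
theorem fderiv_liapunov_radial_pos (hdet : ∀ v, (X.inductanceMatrix v).det ≠ 0)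
    (hloop : net.NoInductorLoop) {qe : Coord m} (he : X.birkhoffian.IsEquilibrium qe)
    {z : Phase m} (hL : ∀ a, 0 < net.L a (X.current a z.2))
    (hC : ∀ α, X.charge α z.1 ≠ X.charge α qe →
      0 < (net.C α (X.charge α z.1) - net.C α (X.charge α qe)) *
        (X.charge α z.1 - X.charge α qe)) (hz : z ≠ (qe, 0)) :
    0 < fderiv ℝ (X.liapunov qe) z (z - (qe, 0)) := by
  rw [fderiv_liapunov, fderiv_energy_apply]
  have h1 : ∑ a, net.L a (X.current a z.2) * X.current a z.2 *
      X.branch (Sum.inl a) (z - (qe, 0)).2 =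
      ∑ a, net.L a (X.current a z.2) * X.branch (Sum.inl a) z.2 ^ 2 :=
    Finset.sum_congr rfl fun a _ => by
      rw [Prod.snd_sub, sub_zero, ← current_eq]
      ring
  rw [h1, Prod.fst_sub, X.sum_mul_branch_sub he]
  by_cases hv : z.2 = 0
  · have hq : z.1 ≠ qe := fun hq => hz (Prod.ext hq hv)
    exact add_pos_of_nonneg_of_pos
      (Finset.sum_nonneg fun a _ => mul_nonneg (hL a).le (sq_nonneg _))
      (X.sum_capacitor_pos hloop hC hq)
  · refine add_pos_of_pos_of_nonneg (X.sum_inductor_pos (hdet _) hL hv) ?_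
    by_cases hq : z.1 = qe
    · simp [hq]
    · exact (X.sum_capacitor_pos hloop hC hq).le

/-- The Liapunov function increases along the rays in a small ball, and has a positive lower bound
on its boundary. -/
theorem exists_radius_radial (hdet : ∀ v, (X.inductanceMatrix v).det ≠ 0)
    (hloop : net.NoInductorLoop) {qe : Coord m} (he : X.birkhoffian.IsEquilibrium qe)
    (hL : ∀ a, 0 < net.L a 0) (hC : ∀ α, 0 < deriv (net.C α) (X.charge α qe))
    {Ω : Set (Phase m)} (hΩ : IsOpen Ω) (hmem : (qe, (0 : Coord m)) ∈ Ω) :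
    ∃ r b : ℝ, 0 < r ∧ 0 < b ∧ closedBall (qe, (0 : Coord m)) r ⊆ Ω ∧
      (∀ z ∈ sphere (qe, (0 : Coord m)) r, b ≤ X.liapunov qe z) ∧
      (∀ z ∈ closedBall (qe, (0 : Coord m)) r, z ≠ (qe, 0) →
        0 < fderiv ℝ (X.liapunov qe) z (z - (qe, 0))) ∧
      ∀ z ∈ closedBall (qe, (0 : Coord m)) r, (∀ a, 0 < net.L a (X.current a z.2)) ∧
        ∀ α, X.charge α z.1 ≠ X.charge α qe →
          0 < (net.C α (X.charge α z.1) - net.C α (X.charge α qe)) *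
            (X.charge α z.1 - X.charge α qe) := by
  obtain ⟨r, hr, hrΩ, hpass⟩ := X.exists_radius_passive qe hL hC hΩ hmem
  have hrad : ∀ z ∈ closedBall (qe, (0 : Coord m)) r, z ≠ (qe, 0) →
      0 < fderiv ℝ (X.liapunov qe) z (z - (qe, 0)) := fun z hz hne =>
    X.fderiv_liapunov_radial_pos hdet hloop he (hpass z hz).1 (hpass z hz).2 hne
  obtain ⟨b, hb, hsph⟩ := exists_pos_le_on_sphere (X.differentiable_liapunov qe).continuous
    (z₀ := (qe, (0 : Coord m))) (r := r) fun z hz => by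
      have h := lt_of_mem_closedBall_of_radial (X.differentiable_liapunov qe) hrad
        (sphere_subset_closedBall hz) (ne_of_mem_sphere hz hr.ne')
      rwa [liapunov_self] at h
  exact ⟨r, b, hr, hb, hrΩ, hsph, hrad, hpass⟩

/-- Motions that start near the equilibrium with low energy remain in a ball. -/
theorem mem_ball_of_isMotionOn {qe : Coord m} {r b : ℝ}
    (hsph : ∀ z ∈ sphere (qe, (0 : Coord m)) r, b ≤ X.liapunov qe z) {I : Set ℝ}
    (hI : I.OrdConnected) {γ : ℝ → Phase m} (hγ : X.birkhoffian.IsMotionOn γ I) {s t : ℝ}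
    (hs : s ∈ I) (ht : t ∈ I) (hsr : γ s ∈ ball (qe, (0 : Coord m)) r)
    (hsb : X.liapunov qe (γ s) < b) : γ t ∈ ball (qe, (0 : Coord m)) r := by
  refine mem_ball_of_lt_on_sphere hsph hI (fun t ht => ?_) (fun t ht => ?_) hs ht hsr
  · obtain ⟨w, hw, -⟩ := hγ t ht
    exact hw.continuousWithinAt
  · rwa [liapunov, X.energy_eq_of_isMotionOn hI hγ ht hs]

/-- `Ω₁` is the part of the ball where `V` lies below its bound `b` on the sphere. Conservation of
energy keeps motions from reaching the sphere. -/
theorem isStable (hdet : ∀ v, (X.inductanceMatrix v).det ≠ 0)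
    (hloop : net.NoInductorLoop) {qe : Coord m} (he : X.birkhoffian.IsEquilibrium qe)
    (hL : ∀ a, 0 < net.L a 0) (hC : ∀ α, 0 < deriv (net.C α) (X.charge α qe)) :
    X.birkhoffian.IsStable qe := by
  intro Ω hΩ hmem
  obtain ⟨r, b, hr, hb, hrΩ, hsph, -⟩ := X.exists_radius_radial hdet hloop he hL hC hΩ hmem
  have hV := X.differentiable_liapunov qe
  have hball : ball (qe, (0 : Coord m)) r ⊆ Ω := ball_subset_closedBall.trans hrΩ
  refine ⟨ball (qe, 0) r ∩ {z | X.liapunov qe z < b},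
    isOpen_ball.inter (isOpen_lt hV.continuous continuous_const),
    ⟨mem_ball_self hr, (X.liapunov_self qe).trans_lt hb⟩, fun z hz => hball hz.1,
    fun z hz => ⟨?_, fun T γ hγ h0 t ht => ?_⟩⟩
  · obtain ⟨γ, h0, hγ⟩ := exists_solution_of_lt_on_sphere (X.contDiff_field hdet) hV
      (X.fderiv_liapunov_field hdet qe) hsph hz.1 hz.2
    exact ⟨γ, X.isMotionOn_of_hasDerivAt hdet hγ _, h0⟩
  · exact hball (X.mem_ball_of_isMotionOn hsph ordConnected_Ico hγ
      ⟨le_rfl, ht.1.trans_lt ht.2⟩ ht (h0 ▸ hz.1) (h0 ▸ hz.2))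

theorem isCenterWith_liapunov (hdet : ∀ v, (X.inductanceMatrix v).det ≠ 0)
    (hloop : net.NoInductorLoop) {qe : Coord m} (he : X.birkhoffian.IsEquilibrium qe)
    (hL : ∀ a, 0 < net.L a 0) (hC : ∀ α, 0 < deriv (net.C α) (X.charge α qe)) :
    X.birkhoffian.IsCenterWith qe (X.liapunov qe) := by
  obtain ⟨r, b, hr, hb, -, hsph, hrad, -⟩ :=
    X.exists_radius_radial hdet hloop he hL hC isOpen_univ (mem_univ _)
  have hV := X.differentiable_liapunov qe
  have hzero : ∀ q v w : Coord m, (q, v) ∈ ball (qe, (0 : Coord m)) r →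
      (∀ j, X.birkhoffian q v w j = 0) → fderiv ℝ (X.liapunov qe) (q, v) (v, w) = 0 :=
    fun q v w _ h => by rw [fderiv_liapunov, X.fderiv_energy_eq_zero h]
  refine ⟨ball (qe, 0) r, ⟨isOpen_ball, mem_ball_self hr, (X.contDiff_liapunov qe).of_le (by simp),
    X.liapunov_self qe, fun z hz hne => ?_, fun q v w hz h => (hzero q v w hz h).le⟩, hzero,
    -- Half of the bound keeps the levels strictly below the values of `V` on the sphere.
    b / 2, half_pos hb, fun d hd hdb => ?_⟩
  · have h := lt_of_mem_closedBall_of_radial hV hrad (ball_subset_closedBall hz) hne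
    rwa [liapunov_self] at h
  · have hlt : ∀ z ∈ sphere (qe, (0 : Coord m)) r, d < X.liapunov qe z := fun z hz =>
      lt_of_lt_of_le (by linarith) (hsph z hz)
    exact ⟨isCompact_level_of_lt_on_sphere hV.continuous hlt, fun u hu =>
      existsUnique_ray_level hV hr hrad ((X.liapunov_self qe).trans_lt hd) hlt hu⟩

/-! ### Periodic motions in one degree of freedom -/

theorem coord_one_ext {u v : Coord 1} (h : u 0 = v 0) : u = v := by
  funext i
  rw [Subsingleton.elim i 0, h]

/-- With one degree of freedom, the motions rotate clockwise around the equilibrium. -/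
theorem rotation_neg (X : net.Coordinates c 1) (hdet : ∀ v, (X.inductanceMatrix v).det ≠ 0)
    (hloop : net.NoInductorLoop) {qe : Coord 1} (he : X.birkhoffian.IsEquilibrium qe)
    {z : Phase 1} (hL : ∀ a, 0 < net.L a (X.current a z.2))
    (hC : ∀ α, X.charge α z.1 ≠ X.charge α qe →
      0 < (net.C α (X.charge α z.1) - net.C α (X.charge α qe)) *
        (X.charge α z.1 - X.charge α qe)) (hz : z ≠ (qe, 0)) :
    (z.1 0 - qe 0) * X.accel z.1 z.2 0 - z.2 0 ^ 2 < 0 := by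
  set w := X.accel z.1 z.2 with hw
  have hQ := (X.birkhoffian_eq_zero_iff (hdet z.2) z.1 w).2 rfl
  -- Pairing the equation of motion with the displacement gives `S * ((q - qe) * w) + P = 0`, where
  -- `S > 0` is the inductance and `P > 0` unless `q = qe`. In the latter case `-v²` is negative.
  have h := X.sum_birkhoffian_mul z.1 z.2 w (z.1 - qe)
  simp only [hQ, zero_mul, Finset.sum_const_zero] at h
  rw [X.sum_mul_branch_sub he] at h
  have hS := X.sum_inductor_pos (hdet z.2) hL (u := Pi.single 0 1) (by simp)
  simp only [branch_single] at hS
  have h1 : ∑ a, net.L a (X.current a z.2) * X.branch (Sum.inl a) w *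
      X.branch (Sum.inl a) (z.1 - qe) =
      (∑ a, net.L a (X.current a z.2) * X.N (Sum.inl a) 0 ^ 2) *
        ((z.1 0 - qe 0) * w 0) := by
    rw [Finset.sum_mul]
    refine Finset.sum_congr rfl fun a _ => ?_
    simp only [branch_apply, Fin.sum_univ_one, Pi.sub_apply]
    ring
  rw [h1] at h
  by_cases hq : z.1 = qe
  · have hv : z.2 0 ≠ 0 := fun hv => hz (Prod.ext hq (coord_one_ext hv))
    have := pow_pos (abs_pos.2 hv) 2
    rw [sq_abs] at this
    rw [hq, sub_self, zero_mul]
    linarith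
  · have hpos := X.sum_capacitor_pos hloop hC hq
    have hneg : (z.1 0 - qe 0) * w 0 < 0 := by
      by_contra! hcon
      have := mul_nonneg hS.le hcon
      linarith
    linarith [sq_nonneg (z.2 0)]

/-- Rotation forces returns to the line `q = qe`. There the sign of the velocity determines the
state, because the level set meets each of the two half-lines once. -/
theorem hasPeriodicMotionsNear (X : net.Coordinates c 1)
    (hdet : ∀ v, (X.inductanceMatrix v).det ≠ 0)
    (hloop : net.NoInductorLoop) {qe : Coord 1} (he : X.birkhoffian.IsEquilibrium qe)
    (hL : ∀ a, 0 < net.L a 0) (hC : ∀ α, 0 < deriv (net.C α) (X.charge α qe)) :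
    X.birkhoffian.HasPeriodicMotionsNear qe := by
  obtain ⟨r, b, hr, hb, -, hsph, hrad, hpass⟩ :=
    X.exists_radius_radial hdet hloop he hL hC isOpen_univ (mem_univ _)
  have hV := X.differentiable_liapunov qe
  refine ⟨ball (qe, 0) r ∩ {z | X.liapunov qe z < b},
    isOpen_ball.inter (isOpen_lt hV.continuous continuous_const),
    ⟨mem_ball_self hr, (X.liapunov_self qe).trans_lt hb⟩, fun γ hγ h0 => ?_⟩
  have hball : ∀ t ∈ Ici (0 : ℝ), γ t ∈ ball (qe, (0 : Coord 1)) r := fun t ht =>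
    X.mem_ball_of_isMotionOn hsph ordConnected_Ici hγ self_mem_Ici ht h0.1 h0.2
  set d := X.liapunov qe (γ 0) with hd
  have hlev : ∀ t ∈ Ici (0 : ℝ), X.liapunov qe (γ t) = d := fun t ht => by
    rw [hd, liapunov, liapunov, X.energy_eq_of_isMotionOn ordConnected_Ici hγ ht self_mem_Ici]
  have hpos : ∀ z ∈ ball (qe, (0 : Coord 1)) r, z ≠ (qe, 0) → 0 < X.liapunov qe z :=
    fun z hz hne => by
      have h := lt_of_mem_closedBall_of_radial hV hrad (ball_subset_closedBall hz) hne
      rwa [liapunov_self] at h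
  by_cases hd0 : γ 0 = (qe, 0)
  · have hrest : ∀ t ∈ Ici (0 : ℝ), γ t = (qe, 0) := fun t ht => by
      by_contra hne
      have h := hpos _ (hball t ht) hne
      rw [hlev t ht, hd, hd0, liapunov_self] at h
      exact h.false
    exact ⟨1, one_pos, fun t ht => by
      rw [hrest t ht, hrest (t + 1) (add_nonneg ht zero_le_one)]⟩
  have hdpos : 0 < d := hpos _ h0.1 hd0
  have hlt : ∀ z ∈ sphere (qe, (0 : Coord 1)) r, d < X.liapunov qe z := fun z hz =>
    lt_of_lt_of_le h0.2 (hsph z hz)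
  have hne : ∀ z ∈ {z ∈ ball (qe, (0 : Coord 1)) r | X.liapunov qe z = d}, z ≠ (qe, 0) := by
    rintro z hz rfl
    exact hdpos.ne ((X.liapunov_self qe).symm.trans hz.2)
  have hf := X.contDiff_field hdet
  have hsq {z : Phase 1} (hz : z ≠ (qe, 0)) : 0 < (z.1 0 - qe 0) ^ 2 + z.2 0 ^ 2 := by
    by_contra! h
    refine hz (Prod.ext (coord_one_ext ?_) (coord_one_ext ?_)) <;>
      simp only [Pi.zero_apply] <;> nlinarith [sq_nonneg (z.1 0 - qe 0), sq_nonneg (z.2 0)]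
  -- The level set is compact and avoids the equilibrium, so the angular velocity attains a maximum
  -- on it, which is negative; `ε` is minus this maximum.
  obtain ⟨ε, hε, hrot⟩ : ∃ ε : ℝ, 0 < ε ∧
      ∀ z ∈ {z ∈ ball (qe, (0 : Coord 1)) r | X.liapunov qe z = d},
        (z.1 0 - qe 0) * X.accel z.1 z.2 0 - z.2 0 ^ 2 ≤
          -ε * ((z.1 0 - qe 0) ^ 2 + z.2 0 ^ 2) := by
    have hca : Continuous fun z : Phase 1 => X.accel z.1 z.2 0 :=
      (continuous_apply (A := fun _ : Fin 1 => ℝ) 0).comp (continuous_snd.comp hf.continuous)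
    obtain ⟨z, hz, hmax⟩ := (isCompact_level_of_lt_on_sphere hV.continuous hlt).exists_isMaxOn
      ⟨γ 0, h0.1, rfl⟩ (f := fun z => ((z.1 0 - qe 0) * X.accel z.1 z.2 0 - z.2 0 ^ 2) /
        ((z.1 0 - qe 0) ^ 2 + z.2 0 ^ 2))
      (ContinuousOn.div (by fun_prop) (by fun_prop) fun z hz => (hsq (hne z hz)).ne')
    have hz' := hpass z (ball_subset_closedBall hz.1)
    refine ⟨-(((z.1 0 - qe 0) * X.accel z.1 z.2 0 - z.2 0 ^ 2) /
        ((z.1 0 - qe 0) ^ 2 + z.2 0 ^ 2)), ?_, fun y hy => ?_⟩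
    · exact neg_pos.2 (div_neg_of_neg_of_pos
        (X.rotation_neg hdet hloop he hz'.1 hz'.2 (hne z hz)) (hsq (hne z hz)))
    · rw [neg_neg, ← div_le_iff₀ (hsq (hne y hy))]
      exact hmax hy
  have hder : ∀ t ∈ Ici (0 : ℝ), HasDerivWithinAt γ (X.field (γ t)) (Ici 0) t := fun t ht =>
    X.hasDerivWithinAt_of_isMotionOn hdet hγ ht
  have hreturn (t₀ : ℝ) (ht₀ : 0 < t₀) : ∃ t, t₀ ≤ t ∧ (γ t).1 0 - qe 0 = 0 := by
    have hd (t : ℝ) (ht : t₀ ≤ t) : HasDerivAt γ (X.field (γ t)) t :=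
      (hder t (ht₀.le.trans ht)).hasDerivAt (Ici_mem_nhds (ht₀.trans_le ht))
    refine exists_eq_zero_of_rotation (y := fun t => (γ t).2 0)
      (w := fun t => X.accel (γ t).1 (γ t).2 0) hε (fun t ht => ?_) (fun t ht => ?_)
      fun t ht => hrot _ ⟨hball t (ht₀.le.trans ht), hlev t (ht₀.le.trans ht)⟩
    · exact (hasDerivAt_pi.1 (hd t ht).fst 0).sub_const _
    · exact hasDerivAt_pi.1 (hd t ht).snd 0
  -- With velocities of equal sign, both states lie on the ray in direction `(0, (γ s).2)`, at the
  -- parameters `1` and `(γ t).2 0 / (γ s).2 0`.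
  have hside {s t : ℝ} (hs : 0 < s) (ht : 0 < t) (hs0 : (γ s).1 0 - qe 0 = 0)
      (ht0 : (γ t).1 0 - qe 0 = 0) (hst : 0 < (γ s).2 0 * (γ t).2 0) : γ s = γ t := by
    have hs1 : (γ s).2 0 ≠ 0 := fun h => by simp [h] at hst
    have hu : ((0, (γ s).2) : Phase 1) ≠ 0 := fun h => hs1 (by
      rw [Prod.mk_eq_zero] at h
      rw [h.2, Pi.zero_apply])
    have hes : (qe, (0 : Coord 1)) + (1 : ℝ) • ((0, (γ s).2) : Phase 1) = γ s := by
      refine Prod.ext (coord_one_ext ?_) (coord_one_ext ?_)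
      · simp; linarith
      · simp
    have het : (qe, (0 : Coord 1)) + ((γ t).2 0 / (γ s).2 0) • ((0, (γ s).2) : Phase 1) = γ t := by
      refine Prod.ext (coord_one_ext ?_) (coord_one_ext ?_)
      · simp; linarith
      · simp [hs1]
    have hquot : 0 < (γ t).2 0 / (γ s).2 0 := by
      have := div_pos hst (by positivity : 0 < (γ s).2 0 ^ 2)
      rwa [sq, mul_div_mul_left _ _ hs1] at this
    have h := (existsUnique_ray_level hV hr hrad ((X.liapunov_self qe).trans_lt hdpos) hlt
      hu).unique (y₁ := 1) (y₂ := (γ t).2 0 / (γ s).2 0)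
      ⟨one_pos, by rw [hes]; exact ⟨hball s hs.le, hlev s hs.le⟩⟩
      ⟨hquot, by rw [het]; exact ⟨hball t ht.le, hlev t ht.le⟩⟩
    rw [← hes, ← het, ← h]
  have hperiod {s t : ℝ} (hs : 0 < s) (hst : s < t) (h : γ s = γ t) :
      ∃ T : ℝ, 0 < T ∧ ∀ u : ℝ, 0 ≤ u → γ (u + T) = γ u :=
    ⟨t - s, sub_pos.2 hst, fun u hu => periodic_of_eq_of_mem_closedBall hf hr hder
      (fun v hv => ball_subset_closedBall (hball v hv)) hs hst h hu⟩
  have hv0 {t : ℝ} (ht : 0 < t) (h : (γ t).1 0 - qe 0 = 0) : (γ t).2 0 ≠ 0 := fun hv =>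
    hne (γ t) ⟨hball t ht.le, hlev t ht.le⟩
      (Prod.ext (coord_one_ext (sub_eq_zero.1 h)) (coord_one_ext hv))
  -- Three returns with nonzero velocities: two of the velocities have the same sign. The times are
  -- positive because the periodicity lemma needs a two-sided neighbourhood of the first one.
  obtain ⟨t₁, h₁, hz₁⟩ := hreturn 1 one_pos
  obtain ⟨t₂, h₂, hz₂⟩ := hreturn (t₁ + 1) (by linarith)
  obtain ⟨t₃, h₃, hz₃⟩ := hreturn (t₂ + 1) (by linarith)
  have p₁ : 0 < t₁ := by linarith
  have p₂ : 0 < t₂ := by linarith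
  have p₃ : 0 < t₃ := by linarith
  by_cases c₁₂ : 0 < (γ t₁).2 0 * (γ t₂).2 0
  · exact hperiod p₁ (by linarith) (hside p₁ p₂ hz₁ hz₂ c₁₂)
  by_cases c₂₃ : 0 < (γ t₂).2 0 * (γ t₃).2 0
  · exact hperiod p₂ (by linarith) (hside p₂ p₃ hz₂ hz₃ c₂₃)
  have n₁₂ := lt_of_le_of_ne (not_lt.1 c₁₂) (mul_ne_zero (hv0 p₁ hz₁) (hv0 p₂ hz₂))
  have n₂₃ := lt_of_le_of_ne (not_lt.1 c₂₃) (mul_ne_zero (hv0 p₂ hz₂) (hv0 p₃ hz₃))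
  refine hperiod p₁ (by linarith) (hside p₁ p₃ hz₁ hz₃ ?_)
  have h := mul_pos_of_neg_of_neg n₁₂ n₂₃
  have he : (γ t₁).2 0 * (γ t₂).2 0 * ((γ t₂).2 0 * (γ t₃).2 0) =
      (γ t₂).2 0 ^ 2 * ((γ t₁).2 0 * (γ t₃).2 0) := by ring
  rw [he] at h
  exact pos_of_mul_pos_right h (sq_nonneg _)

end LCNetwork.Coordinates

/-! ### A network with several equilibria -/

namespace LCNetwork

/-- A triangle formed by an inductor and two capacitors, whose characteristics are
`1`, `2 + sin` and `-2 + sin`. -/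
noncomputable def triangle : LCNetwork 2 1 2 where
  src := Sum.elim (fun _ => 0) (fun α => if α = 0 then 1 else 2)
  tgt := Sum.elim (fun _ => 1) (fun α => if α = 0 then 2 else 0)
  connected := by
    have h01 : Relation.EqvGen (fun x y : Fin 3 => ∃ e : Fin 1 ⊕ Fin 2,
        Sum.elim (fun _ => 0) (fun α => if α = 0 then 1 else 2) e = x ∧
        Sum.elim (fun _ => 1) (fun α => if α = 0 then 2 else 0) e = y) 0 1 :=
      .rel _ _ ⟨Sum.inl 0, rfl, rfl⟩
    have h12 : Relation.EqvGen (fun x y : Fin 3 => ∃ e : Fin 1 ⊕ Fin 2,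
        Sum.elim (fun _ => 0) (fun α => if α = 0 then 1 else 2) e = x ∧
        Sum.elim (fun _ => 1) (fun α => if α = 0 then 2 else 0) e = y) 1 2 :=
      .rel _ _ ⟨Sum.inr 0, rfl, rfl⟩
    have h0 (x : Fin 3) : Relation.EqvGen (fun x y : Fin 3 => ∃ e : Fin 1 ⊕ Fin 2,
        Sum.elim (fun _ => 0) (fun α => if α = 0 then 1 else 2) e = x ∧
        Sum.elim (fun _ => 1) (fun α => if α = 0 then 2 else 0) e = y) 0 x := by
      fin_cases x
      exacts [.refl _, h01, h01.trans _ _ _ h12]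
    exact fun x y => ((h0 x).symm _ _).trans _ _ _ (h0 y)
  ref := 0
  L := fun _ _ => 1
  C := fun α x => (if α = 0 then 2 else -2) + Real.sin x
  smooth_L := fun _ => contDiff_const
  smooth_C := fun _ => contDiff_const.add Real.contDiff_sin

theorem triangle_mulVec_eq_zero_iff (x : Fin 1 ⊕ Fin 2 → ℝ) :
    triangle.incidence.transpose.mulVec x = 0 ↔
      x (Sum.inr 0) = x (Sum.inl 0) ∧ x (Sum.inr 1) = x (Sum.inl 0) := by
  have key (y : {y : Fin 3 // y ≠ triangle.ref}) : triangle.incidence.transpose.mulVec x y =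
      ((if (0 : Fin 3) = y then 1 else 0) - (if (1 : Fin 3) = y then 1 else 0)) * x (Sum.inl 0) +
      (((if (1 : Fin 3) = y then 1 else 0) - (if (2 : Fin 3) = y then 1 else 0)) * x (Sum.inr 0) +
      ((if (2 : Fin 3) = y then 1 else 0) - (if (0 : Fin 3) = y then 1 else 0)) *
        x (Sum.inr 1)) := by
    have hentry (e : Fin 1 ⊕ Fin 2) : triangle.incidence.transpose y e =
        (if triangle.src e = y then 1 else 0) - (if triangle.tgt e = y then 1 else 0) := rfl
    simp only [Matrix.mulVec, dotProduct, hentry, Fintype.sum_sum_type, Fin.sum_univ_one,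
      Fin.sum_univ_two]
    rfl
  rw [funext_iff]
  simp only [key, Pi.zero_apply]
  constructor
  · intro h
    have h1 := h ⟨1, by simp [triangle]⟩
    have h2 := h ⟨2, by simp [triangle]⟩
    simp at h1 h2
    constructor <;> linarith
  · rintro ⟨h1, h2⟩ ⟨y, hy⟩
    rw [h1, h2]
    ring

theorem triangle_noInductorLoop : triangle.NoInductorLoop := by
  intro x hx h
  obtain ⟨h0, -⟩ := (triangle_mulVec_eq_zero_iff x).1 hx
  funext e
  rcases e with a | α
  · rw [Subsingleton.elim a 0, ← h0, h, Pi.zero_apply]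
  · exact h α

/-- The loop current as coordinate. -/
def triangleCoordinates : triangle.Coordinates 0 1 where
  N := Matrix.of fun _ _ => 1
  K := 0
  injective := fun u v h => by
    have := congrFun h (Sum.inl 0)
    funext i
    simpa [Matrix.mulVec, dotProduct, Subsingleton.elim i 0] using this
  range_eq := by
    ext x
    simp only [configSpace, Set.mem_ofPred_eq, triangle_mulVec_eq_zero_iff, Set.mem_range, add_zero]
    constructor
    · rintro ⟨q, rfl⟩
      simp [Matrix.mulVec, dotProduct]
    · rintro ⟨h1, h2⟩
      refine ⟨fun _ => x (Sum.inl 0), ?_⟩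
      funext e
      rcases e with a | α
      · simp [Matrix.mulVec, dotProduct, Subsingleton.elim a 0]
      · fin_cases α <;> simp [Matrix.mulVec, dotProduct, h1, h2]

/-- The loop charge passes through both capacitors, so the constants `2` and `-2` cancel and the
total voltage is `2 sin q`, although neither characteristic vanishes. -/
theorem triangle_isEquilibrium {qe : Coord 1} (h : Real.sin (qe 0) = 0) :
    triangleCoordinates.birkhoffian.IsEquilibrium qe := by
  intro j
  simp [Coordinates.birkhoffian, triangleCoordinates, Coordinates.charge, triangle, h]

end LCNetwork

/-! ### The theorem -/

theorem theorem2 :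
    (∀ (n k p m : ℕ) (net : LCNetwork n k p)
      (c : {x : Fin (n + 1) // x ≠ net.ref} → ℝ) (X : net.Coordinates c m),
      -- regularity of the Birkhoffian is the condition on the inductance matrix
      (X.birkhoffian.IsRegular ↔ ∀ v : Coord m, (X.inductanceMatrix v).det ≠ 0) ∧
      (X.birkhoffian.IsRegular →
        -- the energy given by the iterated integrals is conserved
        X.birkhoffian.IsConservativeWith X.energy ∧
        (∀ (I : Set ℝ) (γ : ℝ → Phase m), I.OrdConnected → X.birkhoffian.IsMotionOn γ I →
          ∀ s ∈ I, ∀ t ∈ I, X.energy (γ s) = X.energy (γ t)) ∧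
        ∀ qe : Coord m,
          -- the equation of the equilibria
          (X.birkhoffian.IsEquilibrium qe ↔
            ∀ j, ∑ α, X.N (Sum.inr α) j *
              net.C α ((∑ l, X.N (Sum.inr α) l * qe l) + X.K (Sum.inr α)) = 0) ∧
          (X.birkhoffian.IsEquilibrium qe → net.NoInductorLoop → (∀ a, 0 < net.L a 0) →
            (∀ α, 0 < deriv (net.C α)
              ((∑ l, X.N (Sum.inr α) l * qe l) + X.K (Sum.inr α))) →
            -- the Hessian of the Liapunov function
            phaseHessian (X.liapunov qe) (qe, 0) =
              Matrix.fromBlocks (X.inductanceMatrix 0) 0 0 (X.capacitanceMatrix qe) ∧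
            (phaseHessian (X.liapunov qe) (qe, 0)).PosDef ∧
            -- the equilibrium is stable and a center
            X.birkhoffian.IsStable qe ∧
            X.birkhoffian.IsCenterWith qe (X.liapunov qe) ∧
            (m = 1 → X.birkhoffian.HasPeriodicMotionsNear qe)))) ∧
    -- there may be several equilibria: a network with three nodes, one inductor and two
    -- capacitors, with nonvanishing characteristics
    (∃ (net : LCNetwork 2 1 2) (c : {x : Fin 3 // x ≠ net.ref} → ℝ) (X : net.Coordinates c 1),
      (∀ e, net.src e ≠ net.tgt e) ∧ net.NoInductorLoop ∧
      (∀ a y, net.L a y ≠ 0) ∧ (∀ α y, net.C α y ≠ 0) ∧ X.birkhoffian.IsRegular ∧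
      (∀ a, 0 < net.L a 0) ∧
      {qe : Coord 1 | X.birkhoffian.IsEquilibrium qe ∧
        ∀ α, 0 < deriv (net.C α)
          ((∑ l, X.N (Sum.inr α) l * qe l) + X.K (Sum.inr α))}.Nontrivial) := by
  refine ⟨fun n k p m net c X => ⟨X.isRegular_iff, fun hreg => ?_⟩, ?_⟩
  · have hdet := X.isRegular_iff.1 hreg
    refine ⟨X.isConservativeWith_energy,
      fun I γ hI hγ s hs t ht => X.energy_eq_of_isMotionOn hI hγ hs ht,
      fun qe => ⟨X.isEquilibrium_iff qe, fun he hloop hL hC => ?_⟩⟩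
    have hess := X.phaseHessian_liapunov qe
    refine ⟨hess, ?_, X.isStable hdet hloop he hL hC,
      X.isCenterWith_liapunov hdet hloop he hL hC, ?_⟩
    · rw [hess]
      refine (X.posDef_inductanceMatrix (hdet 0) fun a => ?_).fromBlocks_diagonal
        (X.posDef_capacitanceMatrix hloop hC)
      rw [X.current_eq, map_zero]
      exact hL a
    · rintro rfl
      exact X.hasPeriodicMotionsNear hdet hloop he hL hC
  · have hderiv (α : Fin 2) (x : ℝ) : deriv (LCNetwork.triangle.C α) x = Real.cos x := by
      refine (((Real.hasDerivAt_sin x).const_add (if α = 0 then (2 : ℝ) else -2))).deriv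
    -- The two equilibria are `0` and `2π`, where `sin` vanishes and `cos`, the derivative of both
    -- capacitor characteristics, is `1`.
    refine ⟨LCNetwork.triangle, 0, LCNetwork.triangleCoordinates, ?_,
      LCNetwork.triangle_noInductorLoop, fun _ _ => one_ne_zero, ?_, ?_, fun _ => one_pos,
      fun _ => 0, ⟨LCNetwork.triangle_isEquilibrium (by simp), fun α => ?_⟩,
      fun _ => 2 * Real.pi, ⟨LCNetwork.triangle_isEquilibrium (by simp), fun α => ?_⟩, ?_⟩
    · rintro (a | α)
      · simp [LCNetwork.triangle]
      · fin_cases α <;> simp [LCNetwork.triangle]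
    · intro α y
      have h1 := Real.neg_one_le_sin y
      have h2 := Real.sin_le_one y
      fin_cases α
      · have : (2 : ℝ) + Real.sin y ≠ 0 := by linarith
        simpa [LCNetwork.triangle] using this
      · have : (-2 : ℝ) + Real.sin y ≠ 0 := by linarith
        simpa [LCNetwork.triangle] using this
    · rw [LCNetwork.Coordinates.isRegular_iff]
      intro v
      simp [LCNetwork.Coordinates.inductanceMatrix, LCNetwork.triangleCoordinates,
        LCNetwork.triangle]
    · rw [hderiv]
      simp [LCNetwork.triangleCoordinates]
    · rw [hderiv]
      simp [LCNetwork.triangleCoordinates]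
    · intro h
      have := congrFun h 0
      have hpi := Real.pi_pos
      simp at this
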